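/- **Setting.** Let $d\ge 1$, let $\Theta\subset\mathbb R^p$ and $\Theta'\subset\mathbb R^l$ be compact and convex, and let $\theta_0\in\Theta$, $\theta_0'\in\Theta'$. For a family $\{c_\theta\colon\theta\in\Theta\}$ of real functions on $\mathbb R^d$ we say that *Fourier inversion holds* if $c_\theta(s)=\int_{\mathbb R^d}\hat c_\theta(f)e^{\mathrm i\langle f,s\rangle}\,df$ for all $\theta,s$, with $\hat c_\theta$ integrable and $(\theta,f)\mapsto\hat c_\theta(f)$ continuous and strictly positive on $\Theta\times\mathbb R^d$. *Covariance functions.* $\{k_\theta\colon\theta\in\Theta\}$ is a family of real functions on $\mathbb R^d$ such that Fourier inversion holds, $\theta\mapsto k_\theta(s)$ is continuously differentiable on $\Theta$ for every $s$, and there are $A<\infty$, $\alpha>0$ with $|k_\theta(s)|\le A/(1+\|s\|^{d+\alpha})$ and $|\partial k_\theta(s)/\partial\theta_i|\le A/(1+\|s\|^{d+\alpha})$ for all $\theta\in\Theta$, $s\in\mathbb R^d$, $i=1,\dots,p$. *Taper and approximations.* $\{t_{\theta'}\colon\theta'\in\Theta'\}$ is a family of real functions on $\mathbb R^d$ for which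 Fourier inversion holds, the first order partial derivatives in $\theta'$ exist, and the functions and these partial derivatives are bounded and supported in a ball, with bounds and radii independent of $\theta'$. For every $m$, $\{\tilde t_{m,\theta'}\colon\theta'\in\Theta'\}$ is a family of Borel measurable even functions whose first order partial derivatives in $\theta'$ exist, the functions and these partial derivatives being bounded and supported in a ball, with bounds and radii independent of $\theta'$ and $m$; and as $m\to\infty$, $\tilde t_{m,\theta'}\to t_{\theta'}$ and $\partial\tilde t_{m,\theta'}/\partial\theta_i'\to\partial t_{\theta'}/\partial\theta_i'$ uniformly on $\Theta'\times\mathbb R^d$. Write $t=t_{\theta_0'}$, $\tilde t_m=\tilde t_{m,\theta_0'}$, and let $r\colon\mathbb N\to\mathbb N$ satisfy $r(n)\to\infty$. *Sampling.* On a probability space $(\Omega,\mathcal F,\mathbb P)$ let $X_1,X_2,\dots$ be i.i.d. with values in $[-1,1]^d$ and a strictly positive density there; let $\tau\in[0,1/2)$, let $v_1,v_2,\dots$ satisfy $\{v_i\colon 1\le i\le I^d\}=\{1,\dots,I\}^d$ for every $I\in\mathbb N$, and let $S_i=v_i+\tau X_i$. Let $Z=(Z_s)_{s\in\mathbb R^d}$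 be a real, centred Gaussian random field with $\operatorname{Cov}(Z_s,Z_{s'})=k_{\theta_0}(s-s')$, which is jointly measurable and independent of $X=(X_i)_i$, in the sense that there is a $\sigma$-algebra $\mathcal G\subset\mathcal F$ independent of $X$ such that $(s,\omega)\mapsto Z_s(\omega)$ is $\mathfrak B(\mathbb R^d)\otimes\mathcal G$-measurable. Put $Z_{(n)}=(Z_{S_1},\dots,Z_{S_n})$. *Matrices and divergences.* For $1\le i,j\le n$ let $$(K_n)_{ij}=k_{\theta_0}(S_i-S_j),\qquad (R_{n,\theta})_{ij}=k_\theta(S_i-S_j)\,t(S_i-S_j),\qquad (\widetilde R_{n,\theta})_{ij}=k_\theta(S_i-S_j)\,\tilde t_{r(n)}(S_i-S_j),$$ $$d_{n,\theta}=\tfrac1n\log\det(R_{n,\theta}K_n^{-1})+\tfrac1n\operatorname{tr}(K_nR_{n,\theta}^{-1})-1,\qquad \tilde d_{n,\theta}=\tfrac1n\log\det(\widetilde R_{n,\theta}K_n^{-1})+\tfrac1n\operatorname{tr}(K_n\widetilde R_{n,\theta}^{-1})-1 .$$ *Estimators.* Let $\det_+(A)$ be the product of the strictly positive eigenvalues of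 $A$ (equal to $1$ if there are none) and $A^+$ the Moore–Penrose inverse. A sequence of truncated-tapered ML estimators is a sequence of $\Theta$-valued maps $\hat\theta_n(k\tilde t)$ on $\Omega$ such that, for all sufficiently large $n$, almost surely, $\hat\theta_n(k\tilde t)$ minimizes over $\theta\in\Theta$ $$\tilde l_n(\theta)=\tfrac1n\log{\det}_+(\widetilde R_{n,\theta})+\tfrac1n\langle Z_{(n)},\widetilde R_{n,\theta}^{+}Z_{(n)}\rangle .$$ **Theorem.** 0. (The divergences are well defined.) There is a deterministic $N\in\mathbb N$ such that, almost surely, $K_n$ and $R_{n,\theta}$ are positive definite for all $n$ and all $\theta\in\Theta$, and $\widetilde R_{n,\theta}$ is positive definite for all $n\ge N$ and all $\theta\in\Theta$. 1. Almost surely, $\sup_{\theta\in\Theta}|d_{n,\theta}-\tilde d_{n,\theta}|\to0$ as $n\to\infty$. 2. For every sequence of truncated-tapered ML estimators, $d_{n,\hat\theta_n(k\tilde t)}=\inf_{\theta\in\Theta}d_{n,\theta}+\delta_n$, where $\delta_n\to0$ in probability as $n\to\infty$. -/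

import Mathlib

open MeasureTheory ProbabilityTheory Filter Topology
open scoped ENNReal Matrix

noncomputable section

/-- `ℝ^d` with the Euclidean norm. -/
abbrev Euc (d : ℕ) : Type := EuclideanSpace ℝ (Fin d)

/-! ### Linear algebra: pseudo-determinant and Moore-Penrose inverse -/

section LinearAlgebra

variable {n : ℕ}

/-- Product of the strictly positive eigenvalues (with multiplicity) of a square real matrix; it is
`1` if there are none. -/
def detPlus (A : Matrix (Fin n) (Fin n) ℝ) : ℝ :=
  (A.charpoly.roots.filter (fun x => 0 < x)).prod

/-- The four Penrose equations: `B` is the Moore-Penrose inverse of the real matrix `A`. -/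
structure IsMoorePenrose (A B : Matrix (Fin n) (Fin n) ℝ) : Prop where
  mul_mul_left : A * B * A = A
  mul_mul_right : B * A * B = B
  symm_left : (A * B)ᵀ = A * B
  symm_right : (B * A)ᵀ = B * A

theorem IsMoorePenrose.unique {A B C : Matrix (Fin n) (Fin n) ℝ} (hB : IsMoorePenrose A B)
    (hC : IsMoorePenrose A C) : B = C := by
  have h1 : A * B = A * C := by
    have e : (A * C * (A * B))ᵀ = A * C * (A * B) := by
      rw [← mul_assoc, hC.mul_mul_left, hB.symm_left]
    rw [Matrix.transpose_mul, hC.symm_left, hB.symm_left, ← mul_assoc, hB.mul_mul_left,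
      ← mul_assoc, hC.mul_mul_left] at e
    exact e.symm
  have h2 : B * A = C * A := by
    have e : (B * A * (C * A))ᵀ = B * A * (C * A) := by
      rw [mul_assoc, ← mul_assoc A C A, hC.mul_mul_left, hB.symm_right]
    rw [Matrix.transpose_mul, hC.symm_right, hB.symm_right, mul_assoc, ← mul_assoc A B A,
      hB.mul_mul_left, mul_assoc, ← mul_assoc A C A, hC.mul_mul_left] at e
    exact e.symm
  calc B = B * A * B := hB.mul_mul_right.symm
    _ = C * A * B := by rw [h2]
    _ = C * A * C := by rw [mul_assoc, h1, ← mul_assoc]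
    _ = C := hC.mul_mul_right

theorem IsMoorePenrose.of_isUnit {A : Matrix (Fin n) (Fin n) ℝ} (hA : IsUnit A.det) :
    IsMoorePenrose A A⁻¹ := by
  constructor <;> simp [Matrix.mul_nonsing_inv A hA, Matrix.nonsing_inv_mul A hA]

theorem IsMoorePenrose.exists_of_isSymm {A : Matrix (Fin n) (Fin n) ℝ} (hA : A.IsSymm) :
    ∃ B, IsMoorePenrose A B := by
  have hH : A.IsHermitian := by
    rw [Matrix.IsHermitian, Matrix.conjTranspose_eq_transpose_of_trivial]; exact hA
  set φ := Unitary.conjStarAlgAut ℝ (Matrix (Fin n) (Fin n) ℝ) hH.eigenvectorUnitary with hφ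
  set l : Fin n → ℝ := hH.eigenvalues with hl
  have hs : A = φ (Matrix.diagonal l) := by
    have := hH.spectral_theorem
    simpa [hφ, hl, Function.comp_def] using this
  have ht : ∀ w : Fin n → ℝ, (φ (Matrix.diagonal w))ᵀ = φ (Matrix.diagonal w) := by
    intro w
    rw [← Matrix.conjTranspose_eq_transpose_of_trivial, ← Matrix.star_eq_conjTranspose, ← map_star,
      Matrix.star_eq_conjTranspose, Matrix.diagonal_conjTranspose]
    simp
  refine ⟨φ (Matrix.diagonal (fun i => (l i)⁻¹)), ?_, ?_, ?_, ?_⟩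
  · rw [hs, ← map_mul, ← map_mul, Matrix.diagonal_mul_diagonal, Matrix.diagonal_mul_diagonal]
    congr 2
    funext i
    exact mul_inv_mul_cancel (l i)
  · rw [hs, ← map_mul, ← map_mul, Matrix.diagonal_mul_diagonal, Matrix.diagonal_mul_diagonal]
    congr 2
    funext i
    by_cases h : l i = 0
    · simp [h]
    · field_simp
  · rw [hs, ← map_mul, Matrix.diagonal_mul_diagonal, ht]
  · rw [hs, ← map_mul, Matrix.diagonal_mul_diagonal, ht]

open Classical in
/-- The Moore-Penrose inverse `A⁺`. -/
def pinv (A : Matrix (Fin n) (Fin n) ℝ) : Matrix (Fin n) (Fin n) ℝ :=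
  if h : ∃ B, IsMoorePenrose A B then h.choose else 0

theorem pinv_eq {A B : Matrix (Fin n) (Fin n) ℝ} (h : IsMoorePenrose A B) : pinv A = B := by
  have hex : ∃ B, IsMoorePenrose A B := ⟨B, h⟩
  rw [pinv, dif_pos hex]
  exact hex.choose_spec.unique h

/-- The truncated modified log-likelihood
`(1/n) log det₊ A + (1/n) ⟨z, A⁺ z⟩` for the presumed covariance matrix `A` and the data `z`. -/
def truncLogLik (A : Matrix (Fin n) (Fin n) ℝ) (z : Fin n → ℝ) : ℝ :=
  1 / (n : ℝ) * Real.log (detPlus A) + 1 / (n : ℝ) * (z ⬝ᵥ (pinv A *ᵥ z))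

/-- The scaled Kullback-Leibler divergence of `𝒩(0, R)` from `𝒩(0, K)`,
`(1/n) log det (R K⁻¹) + (1/n) tr (K R⁻¹) - 1`. -/
def scaledKL (K R : Matrix (Fin n) (Fin n) ℝ) : ℝ :=
  1 / (n : ℝ) * Real.log (R * K⁻¹).det + 1 / (n : ℝ) * (K * R⁻¹).trace - 1

end LinearAlgebra

/-! ### Sampling scheme -/

section Sampling

variable {d : ℕ}

/-- The cube `[-1, 1]^d`. -/
def cube (d : ℕ) : Set (Euc d) := {x | ∀ j, -1 ≤ x j ∧ x j ≤ 1}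

/-- The sequence of grid points (indexed from `0`): for every `I`, its first `I^d` members are
exactly the points of `{1, …, I}^d`. -/
def IsGridEnumeration (v : ℕ → Fin d → ℕ) : Prop :=
  ∀ I : ℕ, v '' Set.Iio (I ^ d) = {w | ∀ j, 1 ≤ w j ∧ w j ≤ I}

/-- The perturbed grid point `v i + τ x i`. -/
def perturbedGrid (τ : ℝ) (v : ℕ → Fin d → ℕ) (x : ℕ → Euc d) (i : ℕ) : Euc d :=
  WithLp.toLp 2 (fun j => (v i j : ℝ)) + τ • x i

/-- The matrix `[c (s i - s j)]` for the first `n` points of the sequence `s`. -/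
def covMatrix (c : Euc d → ℝ) (s : ℕ → Euc d) (n : ℕ) : Matrix (Fin n) (Fin n) ℝ :=
  Matrix.of fun i j => c (s i - s j)

variable {Ω : Type*} [MeasurableSpace Ω]

/-- `X 0, X 1, …` are independent random vectors with values in the cube and a common law, which
has a strictly positive density on the cube. -/
structure IsPerturbation (P : Measure Ω) (X : ℕ → Ω → Euc d) : Prop where
  measurable : ∀ i, Measurable (X i)
  mem_cube : ∀ i ω, X i ω ∈ cube d
  iIndep : iIndepFun X P
  density : ∃ g : Euc d → ℝ, Measurable g ∧ (∀ x ∈ cube d, 0 < g x) ∧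
    ∀ i, P.map (X i) = (volume.restrict (cube d)).withDensity (fun x => ENNReal.ofReal (g x))

/-- `Z` is a centred Gaussian random field on `ℝ^d` with stationary covariance function `c`. -/
structure IsCenteredGaussianField (P : Measure Ω) (Z : Euc d → Ω → ℝ) (c : Euc d → ℝ) : Prop where
  gaussian : IsGaussianProcess Z P
  mean : ∀ s, ∫ ω, Z s ω ∂P = 0
  cov : ∀ s t, covariance (Z s) (Z t) P = c (s - t)

/-- The jointly measurable random function `Z` is independent of the sequence `X`: there is a
σ-algebra independent of `X` for which `Z` is jointly measurable. (Independence of `X` from the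
σ-algebra generated by the single values `Z s` would not control `Z` at a random location.) -/
def IndepRandomFunction {Ω : Type*} {mΩ : MeasurableSpace Ω} (P : Measure Ω) (Z : Euc d → Ω → ℝ)
    (X : ℕ → Ω → Euc d) : Prop :=
  ∃ 𝒢 : MeasurableSpace Ω, 𝒢 ≤ mΩ ∧
    Measurable[(inferInstance : MeasurableSpace (Euc d)).prod 𝒢]
      (fun q : Euc d × Ω => Z q.1 q.2) ∧
    Indep 𝒢 (MeasurableSpace.comap (fun ω i => X i ω) inferInstance) P

end Sampling

/-! ### Families of covariance functions, tapers and taper approximations -/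

section Families

variable {p l d : ℕ}

/-- Fourier inversion with a density that is jointly continuous and strictly positive:
`c_θ(s) = ∫ ĉ_θ(f) exp(i⟨f, s⟩) df`. -/
def HasPositiveSpectralDensity (Θ : Set (Euc p)) (c : Euc p → Euc d → ℝ) : Prop :=
  ∃ ĉ : Euc p → Euc d → ℝ,
    ContinuousOn (fun q : Euc p × Euc d => ĉ q.1 q.2) (Θ ×ˢ Set.univ) ∧
    ∀ θ ∈ Θ, (∀ f, 0 < ĉ θ f) ∧ Integrable (ĉ θ) ∧
      ∀ s, (c θ s : ℂ) = ∫ f, (ĉ θ f : ℂ) * Complex.exp (Complex.I * (inner ℝ f s : ℝ))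

/-- The family `k_θ`, `θ ∈ Θ`: continuously differentiable in `θ`, with polynomial decay of
`k_θ` and of its partial derivatives in `θ`, and with positive spectral density. -/
structure IsDecayingFamily (Θ : Set (Euc p)) (k : Euc p → Euc d → ℝ) : Prop where
  smooth_decay : ∃ (k' : Euc p → Euc d → (Euc p →L[ℝ] ℝ)) (A α : ℝ), 0 < α ∧
    (∀ s, ∀ θ ∈ Θ, HasFDerivWithinAt (fun η => k η s) (k' θ s) Θ θ) ∧
    (∀ s, ContinuousOn (fun θ => k' θ s) Θ) ∧
    ∀ θ ∈ Θ, ∀ s, |k θ s| ≤ A / (1 + ‖s‖ ^ ((d : ℝ) + α)) ∧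
      ∀ i, |k' θ s (EuclideanSpace.single i 1)| ≤ A / (1 + ‖s‖ ^ ((d : ℝ) + α))
  spectral : HasPositiveSpectralDensity Θ k

/-- For every parameter in `Θ'` the function is bounded by `L` and supported in `B[0; C]`. -/
def BoundedSupported (Θ' : Set (Euc l)) (C L : ℝ) (t : Euc l → Euc d → ℝ) : Prop :=
  ∀ θ ∈ Θ', ∀ s, |t θ s| ≤ L ∧ (C < ‖s‖ → t θ s = 0)

/-- `t'` is the `i`-th partial derivative of `t` with respect to the parameter, along `Θ'`. -/
def IsPartialDeriv (Θ' : Set (Euc l)) (i : Fin l) (t t' : Euc l → Euc d → ℝ) : Prop :=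
  ∀ θ ∈ Θ', ∀ s, HasDerivWithinAt (fun u : ℝ => t (θ + u • EuclideanSpace.single i 1) s) (t' θ s)
    {u | θ + u • EuclideanSpace.single i 1 ∈ Θ'} 0

/-- The family of tapers `t_θ'`, `θ' ∈ Θ'`, with first order partial derivatives `t'`: uniformly
bounded and compactly supported together with the partial derivatives, with positive spectral
density. -/
structure IsTaperFamily (Θ' : Set (Euc l)) (t : Euc l → Euc d → ℝ)
    (t' : Fin l → Euc l → Euc d → ℝ) : Prop where
  bounded : ∃ C L, BoundedSupported Θ' C L t
  hasPartial : ∀ i, IsPartialDeriv Θ' i t (t' i)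
  bounded_deriv : ∃ C L, ∀ i, BoundedSupported Θ' C L (t' i)
  spectral : HasPositiveSpectralDensity Θ' t

/-- The sequences `(t̃_{m,θ'})_m`, `θ' ∈ Θ'`, approximate the family of tapers, together with their
first order partial derivatives. -/
structure IsTaperApproximation (Θ' : Set (Euc l)) (t : Euc l → Euc d → ℝ)
    (t' : Fin l → Euc l → Euc d → ℝ) (tm : ℕ → Euc l → Euc d → ℝ)
    (tm' : ℕ → Fin l → Euc l → Euc d → ℝ) : Prop where
  measurable : ∀ m, ∀ θ ∈ Θ', Measurable (tm m θ)
  even : ∀ m, ∀ θ ∈ Θ', ∀ s, tm m θ s = tm m θ (-s)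
  bounded : ∃ C L, ∀ m, BoundedSupported Θ' C L (tm m)
  tendsto : TendstoUniformlyOn (fun m (q : Euc l × Euc d) => tm m q.1 q.2) (fun q => t q.1 q.2)
    atTop (Θ' ×ˢ Set.univ)
  hasPartial : ∀ m i, IsPartialDeriv Θ' i (tm m) (tm' m i)
  bounded_deriv : ∃ C L, ∀ m i, BoundedSupported Θ' C L (tm' m i)
  tendsto_deriv : ∀ i, TendstoUniformlyOn (fun m (q : Euc l × Euc d) => tm' m i q.1 q.2)
    (fun q => t' i q.1 q.2) atTop (Θ' ×ˢ Set.univ)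

end Families

/-! ### Estimators -/

/-- `θhat n ω` minimizes over `Θ` the truncated modified log-likelihood of the data
`Z (S i ω) ω`, `i < n`, under the presumed covariance function `c n θ`, for all large `n` and
almost all `ω`. -/
def IsTruncatedMLE {p d : ℕ} {Ω : Type*} [MeasurableSpace Ω] (P : Measure Ω) (Θ : Set (Euc p))
    (c : ℕ → Euc p → Euc d → ℝ) (S : ℕ → Ω → Euc d) (Z : Euc d → Ω → ℝ)
    (θhat : ℕ → Ω → Euc p) : Prop :=
  ∀ᶠ n in atTop, ∀ᵐ ω ∂P, θhat n ω ∈ Θ ∧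
    ∀ θ ∈ Θ,
      truncLogLik (covMatrix (c n (θhat n ω)) (fun i => S i ω) n)
          (fun i : Fin n => Z (S i ω) ω) ≤
        truncLogLik (covMatrix (c n θ) (fun i => S i ω) n) (fun i : Fin n => Z (S i ω) ω)

end

/-!
Everything up to the comparison of the two divergences is deterministic: the perturbed grid points
`s i` satisfy `|s i c - v i c| ≤ τ` with `τ < 1 / 2` and pairwise distinct integer points `v i`
(`NearGrid`), and all estimates are uniform over such point configurations.

*Lower bounds for eigenvalues.* By Fourier inversion, `∑ a i a j c (s i - s j)` is the integral of
the spectral density against `|∑ a j exp (i ⟨f, s j⟩)|²`. On a box the density exceeds a multiple of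
the product window `∏ (ρ² - f_c²)₊`. The Fourier transform of the window decays quadratically in
each coordinate, so for large `ρ` its Gram matrix on a perturbed lattice is diagonally dominant
(`exists_integral_windowProd_mul_trigSq_ge`). Compactness of the parameter set makes the bound
uniform (`HasPositiveSpectralDensity.exists_isUniformlyPos`), and the Schur product theorem carries
it to tapered matrices (`IsUniformlyPos.hadamard`).

*Comparison of divergences.* A ball contains boundedly many points, so by Schur's test the two
tapered matrices are close in operator norm
(`eventually_opNorm_covMatrix_taper_sub_le`). Since `log det A - log det B ≤ tr (A B⁻¹) - n` and
`|tr (K B)| ≤ ‖B‖ tr K`, the divergence is Lipschitz in the presumed matrix with a constant free of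
the dimension (`abs_scaledKL_sub_le`).

*Estimators.* Once the presumed matrix is positive definite, the likelihood is the divergence, plus
a term free of the parameter, plus the centred quadratic form
`(1/n) (⟨z, A⁻¹ z⟩ - tr (K A⁻¹))` (`truncLogLik_eq`). Conditionally on the locations, the variance of
the latter is at most a multiple of `‖K‖_F² / n²` (`lintegral_centredForm_sq_le`), and this tends to
zero because the covariance function vanishes at infinity (`eventually_sum_sq_covMatrix_le`). The
form is Lipschitz in the parameter with tight constants, so a finite net gives uniform convergence
in probability (`tendsto_measure_exists_centredForm_ge`). A minimizer of the likelihood therefore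
nearly minimizes the divergence (`sub_ciInf_le_of_minimizer`).
-/

noncomputable section

/-! ### Operator norms and Gaussian divergences of matrices -/

section OperatorBounds

open scoped Matrix.Norms.L2Operator

variable {n : ℕ}

theorem dotProduct_self_eq_norm_sq (x : Fin n → ℝ) : x ⬝ᵥ x = ‖WithLp.toLp 2 x‖ ^ 2 := by
  rw [EuclideanSpace.real_norm_sq_eq]
  simp [dotProduct, pow_two]

theorem norm_toLp_mulVec_le (B : Matrix (Fin n) (Fin n) ℝ) (x : Fin n → ℝ) :
    ‖WithLp.toLp 2 (B *ᵥ x)‖ ≤ ‖B‖ * ‖WithLp.toLp 2 x‖ :=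
  B.l2_opNorm_mulVec (WithLp.toLp 2 x)

theorem abs_dotProduct_le_norm_mul_norm (x y : Fin n → ℝ) :
    |x ⬝ᵥ y| ≤ ‖WithLp.toLp 2 x‖ * ‖WithLp.toLp 2 y‖ := by
  have := abs_real_inner_le_norm (WithLp.toLp 2 y) (WithLp.toLp 2 x)
  rw [EuclideanSpace.inner_eq_star_dotProduct] at this
  simpa [mul_comm] using this

theorem abs_dotProduct_mulVec_self_le (B : Matrix (Fin n) (Fin n) ℝ) (x : Fin n → ℝ) :
    |x ⬝ᵥ B *ᵥ x| ≤ ‖B‖ * (x ⬝ᵥ x) := by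
  calc |x ⬝ᵥ B *ᵥ x| ≤ ‖WithLp.toLp 2 x‖ * ‖WithLp.toLp 2 (B *ᵥ x)‖ :=
        abs_dotProduct_le_norm_mul_norm _ _
    _ ≤ ‖WithLp.toLp 2 x‖ * (‖B‖ * ‖WithLp.toLp 2 x‖) := by
        gcongr; exact norm_toLp_mulVec_le B x
    _ = ‖B‖ * (x ⬝ᵥ x) := by rw [dotProduct_self_eq_norm_sq]; ring

theorem opNorm_le_of_forall_norm_le {B : Matrix (Fin n) (Fin n) ℝ} {c : ℝ} (hc : 0 ≤ c)
    (h : ∀ x : Fin n → ℝ, ‖WithLp.toLp 2 (B *ᵥ x)‖ ≤ c * ‖WithLp.toLp 2 x‖) : ‖B‖ ≤ c := by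
  rw [Matrix.l2_opNorm_def]
  refine ContinuousLinearMap.opNorm_le_bound _ hc fun x => ?_
  exact h x.ofLp

/-- Schur's test for symmetric matrices. -/
theorem opNorm_le_of_rowSum_le {E : Matrix (Fin n) (Fin n) ℝ} (hE : E.IsSymm) {ρ : ℝ}
    (hρ : 0 ≤ ρ) (h : ∀ i, ∑ j, |E i j| ≤ ρ) : ‖E‖ ≤ ρ := by
  refine opNorm_le_of_forall_norm_le hρ fun x => ?_
  have key : ‖WithLp.toLp 2 (E *ᵥ x)‖ ^ 2 ≤ (ρ * ‖WithLp.toLp 2 x‖) ^ 2 := by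
    rw [EuclideanSpace.real_norm_sq_eq, mul_pow, EuclideanSpace.real_norm_sq_eq]
    have row : ∀ i, (E *ᵥ x) i ^ 2 ≤ ρ * ∑ j, |E i j| * x j ^ 2 := by
      intro i
      have h1 : (E *ᵥ x) i ^ 2 ≤ (∑ j, |E i j|) * ∑ j, |E i j| * x j ^ 2 := by
        refine Finset.sum_sq_le_sum_mul_sum_of_sq_le_mul Finset.univ (r := fun j => E i j * x j)
          (f := fun j => |E i j|) (g := fun j => |E i j| * x j ^ 2) (fun j _ => abs_nonneg _)
          (fun j _ => by positivity) fun j _ => ?_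
        rw [mul_pow, ← sq_abs (E i j)]
        exact le_of_eq (by ring)
      exact h1.trans (mul_le_mul_of_nonneg_right (h i)
        (Finset.sum_nonneg fun j _ => by positivity))
    calc ∑ i, (E *ᵥ x) i ^ 2 ≤ ∑ i, ρ * ∑ j, |E i j| * x j ^ 2 :=
          Finset.sum_le_sum fun i _ => row i
      _ = ρ * ∑ j, (∑ i, |E j i|) * x j ^ 2 := by
          rw [← Finset.mul_sum, Finset.sum_comm]
          congr 1
          refine Finset.sum_congr rfl fun j _ => ?_
          rw [Finset.sum_mul]
          refine Finset.sum_congr rfl fun i _ => ?_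
          rw [hE.apply]
      _ ≤ ρ * ∑ j, ρ * x j ^ 2 := by
          gcongr with j
          exact h j
      _ = ρ ^ 2 * ∑ j, x j ^ 2 := by rw [← Finset.mul_sum]; ring
  exact le_of_sq_le_sq key (by positivity)

/-- The symmetric matrix `A` has all its eigenvalues in `[c, ∞)`. -/
structure IsUniformlyPos (c : ℝ) (A : Matrix (Fin n) (Fin n) ℝ) : Prop where
  isSymm : A.IsSymm
  le_form : ∀ x : Fin n → ℝ, c * (x ⬝ᵥ x) ≤ x ⬝ᵥ A *ᵥ x

theorem Matrix.IsSymm.isHermitian_real {A : Matrix (Fin n) (Fin n) ℝ} (h : A.IsSymm) :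
    A.IsHermitian := by
  rw [Matrix.IsHermitian, Matrix.conjTranspose_eq_transpose_of_trivial]; exact h

theorem IsUniformlyPos.posDef {c : ℝ} (hc : 0 < c) {A : Matrix (Fin n) (Fin n) ℝ}
    (hA : IsUniformlyPos c A) : A.PosDef := by
  refine Matrix.PosDef.of_dotProduct_mulVec_pos hA.isSymm.isHermitian_real fun {x} hx => ?_
  have h1 : 0 < x ⬝ᵥ x := by
    have := Matrix.dotProduct_star_self_pos_iff.2 hx
    simpa using this
  simpa using (mul_pos hc h1).trans_le (hA.le_form x)

theorem IsUniformlyPos.opNorm_inv_le {c : ℝ} (hc : 0 < c) {A : Matrix (Fin n) (Fin n) ℝ}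
    (hA : IsUniformlyPos c A) : ‖A⁻¹‖ ≤ c⁻¹ := by
  refine opNorm_le_of_forall_norm_le (by positivity) fun y => ?_
  set x := A⁻¹ *ᵥ y with hx
  have hdet : IsUnit A.det := (hA.posDef hc).det_pos.ne'.isUnit
  have hAx : A *ᵥ x = y := by rw [hx, Matrix.mulVec_mulVec, Matrix.mul_nonsing_inv A hdet,
    Matrix.one_mulVec]
  have h1 := hA.le_form x
  rw [hAx, dotProduct_self_eq_norm_sq] at h1
  have h2 := (le_abs_self _).trans (abs_dotProduct_le_norm_mul_norm x y)
  rw [inv_mul_eq_div, le_div_iff₀ hc]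
  rcases (norm_nonneg (WithLp.toLp 2 x)).eq_or_lt with h0 | h0
  · rw [← h0]; simp
  · nlinarith

theorem IsUniformlyPos.of_opNorm_sub_le {c ε : ℝ} {A B : Matrix (Fin n) (Fin n) ℝ}
    (hA : IsUniformlyPos c A) (hB : B.IsSymm) (h : ‖A - B‖ ≤ ε) : IsUniformlyPos (c - ε) B := by
  refine ⟨hB, fun x => ?_⟩
  have h1 := hA.le_form x
  have h2 := (le_abs_self _).trans (abs_dotProduct_mulVec_self_le (A - B) x)
  rw [Matrix.sub_mulVec, dotProduct_sub] at h2
  have h3 : 0 ≤ x ⬝ᵥ x := by rw [dotProduct_self_eq_norm_sq]; positivity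
  nlinarith

theorem IsUniformlyPos.mono {c c' : ℝ} (h : c' ≤ c) {A : Matrix (Fin n) (Fin n) ℝ}
    (hA : IsUniformlyPos c A) : IsUniformlyPos c' A := by
  refine ⟨hA.isSymm, fun x => le_trans ?_ (hA.le_form x)⟩
  have h3 : 0 ≤ x ⬝ᵥ x := by rw [dotProduct_self_eq_norm_sq]; positivity
  gcongr

theorem opNorm_inv_sub_inv_le {c ε : ℝ} (hc : 0 < c) {A B : Matrix (Fin n) (Fin n) ℝ}
    (hA : IsUniformlyPos c A) (hB : IsUniformlyPos c B) (h : ‖A - B‖ ≤ ε) :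
    ‖A⁻¹ - B⁻¹‖ ≤ ε / c ^ 2 := by
  have hdA : IsUnit A.det := (hA.posDef hc).det_pos.ne'.isUnit
  have hdB : IsUnit B.det := (hB.posDef hc).det_pos.ne'.isUnit
  have e : A⁻¹ - B⁻¹ = A⁻¹ * (B - A) * B⁻¹ := by
    rw [Matrix.mul_sub, Matrix.sub_mul, Matrix.nonsing_inv_mul A hdA, Matrix.mul_assoc,
      Matrix.mul_nonsing_inv B hdB, Matrix.mul_one, Matrix.one_mul]
  have hBA : ‖B - A‖ ≤ ε := by rwa [norm_sub_rev]
  calc ‖A⁻¹ - B⁻¹‖ ≤ ‖A⁻¹‖ * ‖B - A‖ * ‖B⁻¹‖ := by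
        rw [e]
        exact (Matrix.l2_opNorm_mul _ _).trans (by gcongr; exact Matrix.l2_opNorm_mul _ _)
    _ ≤ c⁻¹ * ε * c⁻¹ := by
        have := hA.opNorm_inv_le hc
        have := hB.opNorm_inv_le hc
        have : 0 ≤ ε := (norm_nonneg _).trans h
        gcongr
    _ = ε / c ^ 2 := by field_simp

theorem exists_eq_transpose_mul_self {K : Matrix (Fin n) (Fin n) ℝ} (hK : K.PosSemidef) :
    ∃ M : Matrix (Fin n) (Fin n) ℝ, K = Mᵀ * M := by
  open scoped MatrixOrder in
  obtain ⟨M, hM⟩ := CStarAlgebra.nonneg_iff_eq_star_mul_self.mp hK.nonneg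
  exact ⟨M, by rw [hM, Matrix.star_eq_conjTranspose,
    Matrix.conjTranspose_eq_transpose_of_trivial]⟩

/-- Factoring `K = Mᵀ M` turns the trace into a sum of values of the quadratic form of `B` at the
rows of `M`. -/
theorem abs_trace_mul_le {K : Matrix (Fin n) (Fin n) ℝ} (hK : K.PosSemidef)
    (B : Matrix (Fin n) (Fin n) ℝ) : |(K * B).trace| ≤ ‖B‖ * K.trace := by
  obtain ⟨M, rfl⟩ := exists_eq_transpose_mul_self hK
  have e : ∀ C : Matrix (Fin n) (Fin n) ℝ, (M * C * Mᵀ).trace = ∑ i, M i ⬝ᵥ C *ᵥ M i := by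
    intro C
    refine Finset.sum_congr rfl fun i _ => ?_
    rw [Matrix.diag_apply, Matrix.mul_assoc]
    rfl
  have h1 : (Mᵀ * M * B).trace = ∑ i, M i ⬝ᵥ B *ᵥ M i := by
    rw [← e, Matrix.mul_assoc, Matrix.trace_mul_comm]
  have h2 : (Mᵀ * M).trace = ∑ i, M i ⬝ᵥ M i := by
    rw [Matrix.trace_mul_comm]
    simpa using e 1
  rw [h1, h2, Finset.mul_sum]
  exact (Finset.abs_sum_le_sum_abs _ _).trans
    (Finset.sum_le_sum fun i _ => abs_dotProduct_mulVec_self_le B (M i))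

end OperatorBounds

section Divergence

open scoped Matrix.Norms.L2Operator

variable {n : ℕ}

theorem Matrix.PosDef.log_det_le_trace_sub {C : Matrix (Fin n) (Fin n) ℝ} (hC : C.PosDef) :
    Real.log C.det ≤ C.trace - n := by
  have h1 := hC.1.det_eq_prod_eigenvalues
  have h2 := hC.1.trace_eq_sum_eigenvalues
  simp only [RCLike.ofReal_real_eq_id, id_eq] at h1 h2
  rw [h1, h2, Real.log_prod (fun i _ => (hC.eigenvalues_pos i).ne')]
  calc ∑ i, Real.log (hC.1.eigenvalues i) ≤ ∑ i, (hC.1.eigenvalues i - 1) :=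
        Finset.sum_le_sum fun i _ => Real.log_le_sub_one_of_pos (hC.eigenvalues_pos i)
    _ = _ := by simp

/-- Nonnegativity of the Gaussian Kullback-Leibler divergence, in the form of the concavity
inequality for `log det`. -/
theorem log_det_sub_log_det_le {A B : Matrix (Fin n) (Fin n) ℝ} (hA : A.PosDef) (hB : B.PosDef) :
    Real.log A.det - Real.log B.det ≤ (A * B⁻¹).trace - n := by
  -- with `B = Mᵀ M`, the positive definite matrix `M⁻ᵀ A M⁻¹` has determinant `det A / det B`
  -- and trace `tr (A B⁻¹)`
  obtain ⟨M, hM⟩ := exists_eq_transpose_mul_self hB.posSemidef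
  have hdB := hB.det_pos
  have hdM : IsUnit M.det := by
    rw [hM, Matrix.det_mul, Matrix.det_transpose] at hdB
    exact isUnit_iff_ne_zero.2 fun h => by simp [h] at hdB
  have hMu : IsUnit M := (Matrix.isUnit_iff_isUnit_det _).2 hdM
  have hC : ((M⁻¹)ᴴ * A * M⁻¹).PosDef := by
    refine hA.conjTranspose_mul_mul_same (Matrix.mulVec_injective_iff_isUnit.2 ?_)
    exact (Matrix.isUnit_iff_isUnit_det _).2 (Matrix.isUnit_nonsing_inv_det M hdM)
  rw [Matrix.conjTranspose_eq_transpose_of_trivial] at hC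
  have h1 := hC.log_det_le_trace_sub
  have e1 : ((M⁻¹)ᵀ * A * M⁻¹).det = A.det / B.det := by
    rw [hM, Matrix.det_mul, Matrix.det_mul, Matrix.det_mul, Matrix.det_transpose,
      Matrix.det_transpose, Matrix.det_nonsing_inv, Ring.inverse_eq_inv']
    field_simp
  have e2 : ((M⁻¹)ᵀ * A * M⁻¹).trace = (A * B⁻¹).trace := by
    rw [Matrix.mul_assoc, Matrix.trace_mul_comm, Matrix.mul_assoc, hM, Matrix.mul_inv_rev,
      Matrix.transpose_nonsing_inv]
  rw [e1, e2, Real.log_div hA.det_pos.ne' hB.det_pos.ne'] at h1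
  exact h1

theorem log_det_sub_log_det_le_of_opNorm {c ε : ℝ} (hc : 0 < c) {A B : Matrix (Fin n) (Fin n) ℝ}
    (hA : A.PosDef) (hB : IsUniformlyPos c B) (h : ‖A - B‖ ≤ ε) :
    Real.log A.det - Real.log B.det ≤ n * (ε / c) := by
  have h1 := log_det_sub_log_det_le hA (hB.posDef hc)
  have h2 : (A * B⁻¹).trace - n = (1 * ((A - B) * B⁻¹)).trace := by
    rw [Matrix.one_mul, Matrix.sub_mul, Matrix.trace_sub,
      Matrix.mul_nonsing_inv B (hB.posDef hc).det_pos.ne'.isUnit]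
    simp
  have h3 := (le_abs_self _).trans
    (abs_trace_mul_le (Matrix.PosSemidef.one (n := Fin n) (R := ℝ)) ((A - B) * B⁻¹))
  have h4 : ‖(A - B) * B⁻¹‖ ≤ ε / c := by
    refine (Matrix.l2_opNorm_mul _ _).trans ?_
    rw [div_eq_mul_inv]
    have := hB.opNorm_inv_le hc
    have : 0 ≤ ε := (norm_nonneg _).trans h
    gcongr
  rw [Matrix.trace_one, Fintype.card_fin] at h3
  calc _ ≤ _ := h1
    _ = _ := h2
    _ ≤ _ := h3
    _ ≤ _ := by rw [mul_comm]; gcongr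

theorem abs_log_det_sub_log_det_le {c ε : ℝ} (hc : 0 < c) {A B : Matrix (Fin n) (Fin n) ℝ}
    (hA : IsUniformlyPos c A) (hB : IsUniformlyPos c B) (h : ‖A - B‖ ≤ ε) :
    |Real.log A.det - Real.log B.det| ≤ n * (ε / c) := by
  rw [abs_le]
  have h1 := log_det_sub_log_det_le_of_opNorm hc (hA.posDef hc) hB h
  have h2 := log_det_sub_log_det_le_of_opNorm (ε := ε) hc (hB.posDef hc) hA
    (by rwa [norm_sub_rev])
  constructor <;> linarith

theorem scaledKL_eq {K A : Matrix (Fin n) (Fin n) ℝ} (hK : K.PosDef) (hA : A.PosDef) :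
    scaledKL K A = 1 / (n : ℝ) * (Real.log A.det - Real.log K.det)
      + 1 / (n : ℝ) * (K * A⁻¹).trace - 1 := by
  rw [scaledKL, Matrix.det_mul, Matrix.det_nonsing_inv, Ring.inverse_eq_inv',
    Real.log_mul hA.det_pos.ne' (inv_ne_zero hK.det_pos.ne'), Real.log_inv, ← sub_eq_add_neg]

theorem neg_one_le_scaledKL {K A : Matrix (Fin n) (Fin n) ℝ} (hK : K.PosDef) (hA : A.PosDef) :
    -1 ≤ scaledKL K A := by
  rw [scaledKL_eq hK hA]
  have h := log_det_sub_log_det_le hK hA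
  have : 0 ≤ 1 / (n : ℝ) * ((Real.log A.det - Real.log K.det) + (K * A⁻¹).trace) :=
    mul_nonneg (by positivity) (by have : (0 : ℝ) ≤ n := by positivity
                                   linarith)
  linarith

/-- The divergence is Lipschitz in the presumed covariance matrix, with a constant free of the
dimension, as long as the eigenvalues stay away from zero. -/
theorem abs_scaledKL_sub_le {c ε κ : ℝ} (hc : 0 < c) {K A B : Matrix (Fin n) (Fin n) ℝ}
    (hK : K.PosDef) (hκ : K.trace ≤ n * κ) (hA : IsUniformlyPos c A) (hB : IsUniformlyPos c B)
    (hκ0 : 0 ≤ κ) (h : ‖A - B‖ ≤ ε) :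
    |scaledKL K A - scaledKL K B| ≤ ε / c + ε / c ^ 2 * κ := by
  have hε : 0 ≤ ε := (norm_nonneg _).trans h
  rw [scaledKL_eq hK (hA.posDef hc), scaledKL_eq hK (hB.posDef hc)]
  have h1 := abs_log_det_sub_log_det_le hc hA hB h
  have h2 : |(K * A⁻¹).trace - (K * B⁻¹).trace| ≤ ε / c ^ 2 * (n * κ) := by
    rw [← Matrix.trace_sub, ← Matrix.mul_sub]
    refine (abs_trace_mul_le hK.posSemidef _).trans ?_
    have := opNorm_inv_sub_inv_le hc hA hB h
    gcongr
    exact hK.posSemidef.trace_nonneg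
  have e : 1 / (n : ℝ) * (Real.log A.det - Real.log K.det) + 1 / (n : ℝ) * (K * A⁻¹).trace - 1
      - (1 / (n : ℝ) * (Real.log B.det - Real.log K.det) + 1 / (n : ℝ) * (K * B⁻¹).trace - 1)
      = 1 / (n : ℝ) * ((Real.log A.det - Real.log B.det)
        + ((K * A⁻¹).trace - (K * B⁻¹).trace)) := by ring
  rw [e, abs_mul, abs_of_nonneg (by positivity : 0 ≤ 1 / (n : ℝ))]
  calc 1 / (n : ℝ) * |Real.log A.det - Real.log B.det + ((K * A⁻¹).trace - (K * B⁻¹).trace)|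
      ≤ 1 / (n : ℝ) * (n * (ε / c) + ε / c ^ 2 * (n * κ)) := by
        gcongr; exact (abs_add_le _ _).trans (add_le_add h1 h2)
    _ = (n / n : ℝ) * (ε / c + ε / c ^ 2 * κ) := by ring
    _ ≤ 1 * (ε / c + ε / c ^ 2 * κ) := by
        gcongr; exact div_self_le_one _
    _ = _ := one_mul _

/-- For a positive definite matrix all roots of the characteristic polynomial are positive. -/
theorem detPlus_eq_det {A : Matrix (Fin n) (Fin n) ℝ} (hA : A.PosDef) : detPlus A = A.det := by
  rw [detPlus, hA.1.roots_charpoly_eq_eigenvalues, Multiset.filter_eq_self.2,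
    hA.1.det_eq_prod_eigenvalues]
  · rfl
  · intro x hx
    obtain ⟨i, -, rfl⟩ := Multiset.mem_map.1 hx
    exact hA.eigenvalues_pos i

/-- The normalized centred quadratic form `(1/n) (⟨z, A⁻¹ z⟩ - tr (K A⁻¹))`. -/
def centredForm (K A : Matrix (Fin n) (Fin n) ℝ) (z : Fin n → ℝ) : ℝ :=
  1 / (n : ℝ) * (z ⬝ᵥ A⁻¹ *ᵥ z - (K * A⁻¹).trace)

/-- Up to a term not depending on the presumed covariance matrix, likelihood and divergence differ
by the centred quadratic form. -/
theorem truncLogLik_eq {K A : Matrix (Fin n) (Fin n) ℝ} (hK : K.PosDef) (hA : A.PosDef)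
    (z : Fin n → ℝ) :
    truncLogLik A z = scaledKL K A + centredForm K A z + (1 / (n : ℝ) * Real.log K.det + 1) := by
  rw [truncLogLik, detPlus_eq_det hA, pinv_eq (IsMoorePenrose.of_isUnit hA.det_pos.ne'.isUnit),
    scaledKL_eq hK hA, centredForm]
  ring

theorem abs_centredForm_sub_le {c ε : ℝ} (hc : 0 < c) {K A B : Matrix (Fin n) (Fin n) ℝ}
    (hK : K.PosDef) (hA : IsUniformlyPos c A) (hB : IsUniformlyPos c B) (h : ‖A - B‖ ≤ ε)
    (z : Fin n → ℝ) :
    |centredForm K A z - centredForm K B z|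
      ≤ ε / c ^ 2 * (1 / (n : ℝ) * (z ⬝ᵥ z + K.trace)) := by
  have h0 := opNorm_inv_sub_inv_le hc hA hB h
  have e : centredForm K A z - centredForm K B z
      = 1 / (n : ℝ) * (z ⬝ᵥ (A⁻¹ - B⁻¹) *ᵥ z - (K * (A⁻¹ - B⁻¹)).trace) := by
    rw [centredForm, centredForm, Matrix.sub_mulVec, dotProduct_sub, Matrix.mul_sub,
      Matrix.trace_sub]
    ring
  have hz : 0 ≤ z ⬝ᵥ z := by rw [dotProduct_self_eq_norm_sq]; positivity
  have ht := hK.posSemidef.trace_nonneg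
  rw [e, abs_mul, abs_of_nonneg (by positivity : 0 ≤ 1 / (n : ℝ))]
  calc _ ≤ 1 / (n : ℝ) * (‖A⁻¹ - B⁻¹‖ * (z ⬝ᵥ z) + ‖A⁻¹ - B⁻¹‖ * K.trace) := by
        gcongr
        exact (abs_sub _ _).trans (add_le_add (abs_dotProduct_mulVec_self_le _ _)
          (abs_trace_mul_le hK.posSemidef _))
    _ ≤ 1 / (n : ℝ) * (ε / c ^ 2 * (z ⬝ᵥ z) + ε / c ^ 2 * K.trace) := by gcongr
    _ = _ := by ring

/-- If likelihoods `a` and divergences `b`, `b'` are uniformly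
close up to a constant, a minimizer of `a` nearly minimizes `b`. -/
theorem sub_ciInf_le_of_minimizer {ι : Type*} {a b b' : ι → ℝ} {C u w : ℝ} {i₀ : ι}
    (hmin : ∀ i, a i₀ ≤ a i) (hb : ∀ i, |b i - b' i| ≤ u) (ha : ∀ i, |a i - b' i - C| ≤ w)
    (hbdd : BddBelow (Set.range b)) :
    |b i₀ - ⨅ i, b i| ≤ 2 * u + 2 * w := by
  have : Nonempty ι := ⟨i₀⟩
  have h1 : (⨅ i, b i) ≤ b i₀ := ciInf_le hbdd i₀
  have h2 : b i₀ - (2 * u + 2 * w) ≤ ⨅ i, b i := by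
    refine le_ciInf fun i => ?_
    have := abs_le.1 (hb i₀)
    have := abs_le.1 (hb i)
    have := abs_le.1 (ha i₀)
    have := abs_le.1 (ha i)
    have := hmin i
    linarith
  rw [abs_of_nonneg (by linarith)]
  linarith

/-- Cauchy-Schwarz for the trace form. -/
theorem trace_mul_self_le (Y : Matrix (Fin n) (Fin n) ℝ) :
    (Y * Y).trace ≤ ∑ i, ∑ j, Y i j ^ 2 := by
  have h : ∀ i j, Y i j * Y j i ≤ (Y i j ^ 2 + Y j i ^ 2) / 2 := fun i j => by
    nlinarith [sq_nonneg (Y i j - Y j i)]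
  calc (Y * Y).trace = ∑ i, ∑ j, Y i j * Y j i := by
        simp [Matrix.trace, Matrix.mul_apply]
    _ ≤ ∑ i, ∑ j, (Y i j ^ 2 + Y j i ^ 2) / 2 :=
        Finset.sum_le_sum fun i _ => Finset.sum_le_sum fun j _ => h i j
    _ = (∑ i, ∑ j, Y i j ^ 2 + ∑ i, ∑ j, Y j i ^ 2) / 2 := by
        simp only [← Finset.sum_div, ← Finset.sum_add_distrib]
    _ = _ := by rw [Finset.sum_comm (f := fun i j => Y j i ^ 2)]; ring

theorem sum_sq_mul_le (B K : Matrix (Fin n) (Fin n) ℝ) :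
    ∑ i, ∑ j, (B * K) i j ^ 2 ≤ ‖B‖ ^ 2 * ∑ i, ∑ j, K i j ^ 2 := by
  rw [Finset.sum_comm, Finset.sum_comm (f := fun i j => K i j ^ 2), Finset.mul_sum]
  refine Finset.sum_le_sum fun j _ => ?_
  have h := norm_toLp_mulVec_le B (fun i => K i j)
  have h' := pow_le_pow_left₀ (norm_nonneg _) h 2
  rw [mul_pow, EuclideanSpace.real_norm_sq_eq, EuclideanSpace.real_norm_sq_eq] at h'
  simpa [Matrix.mul_apply, Matrix.mulVec, dotProduct] using h'

theorem trace_mul_mul_mul_le {B K : Matrix (Fin n) (Fin n) ℝ} :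
    (B * K * (B * K)).trace ≤ ‖B‖ ^ 2 * ∑ i, ∑ j, K i j ^ 2 :=
  (trace_mul_self_le _).trans (sum_sq_mul_le B K)

/-- Simultaneous diagonalization: coordinates `V = Q z` in which the covariance matrix `K` becomes
the identity and the quadratic form `B` becomes diagonal. -/
theorem exists_simultaneous_diagonalization {K B : Matrix (Fin n) (Fin n) ℝ} (hK : K.PosDef)
    (hB : B.IsSymm) : ∃ (Q : Matrix (Fin n) (Fin n) ℝ) (l : Fin n → ℝ), Q * K * Qᵀ = 1 ∧
      (∀ z, z ⬝ᵥ B *ᵥ z = ∑ i, l i * (Q *ᵥ z) i ^ 2) ∧ ∑ i, l i = (K * B).trace ∧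
      ∑ i, l i ^ 2 = (B * K * (B * K)).trace := by
  -- with `K = Mᵀ M` and `M B Mᵀ = U diag(l) Uᵀ`, take `Q = Uᵀ M⁻ᵀ`
  obtain ⟨M, hM⟩ := exists_eq_transpose_mul_self hK.posSemidef
  have hdK := hK.det_pos
  have hdM : IsUnit M.det := by
    rw [hM, Matrix.det_mul, Matrix.det_transpose] at hdK
    exact isUnit_iff_ne_zero.2 fun h => by simp [h] at hdK
  have hdMt : IsUnit Mᵀ.det := by rwa [Matrix.det_transpose]
  have hH : (M * B * Mᵀ).IsHermitian := by
    refine Matrix.IsSymm.isHermitian_real ?_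
    rw [Matrix.IsSymm, Matrix.transpose_mul, Matrix.transpose_mul, hB.eq,
      Matrix.transpose_transpose, Matrix.mul_assoc]
  set U : Matrix (Fin n) (Fin n) ℝ := (hH.eigenvectorUnitary).1 with hU
  set l : Fin n → ℝ := hH.eigenvalues with hl
  have hUU : U * Uᵀ = 1 := by
    have := Unitary.coe_mul_star_self hH.eigenvectorUnitary
    simpa [Matrix.star_eq_conjTranspose, Matrix.conjTranspose_eq_transpose_of_trivial] using this
  have hUU' : Uᵀ * U = 1 := mul_eq_one_comm.1 hUU
  have hs : M * B * Mᵀ = U * Matrix.diagonal l * Uᵀ := by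
    have := hH.spectral_theorem
    rw [Unitary.conjStarAlgAut_apply] at this
    simpa [Matrix.star_eq_conjTranspose, Matrix.conjTranspose_eq_transpose_of_trivial,
      Function.comp_def] using this
  have hMM : Mᵀ * Mᵀ⁻¹ = 1 := Matrix.mul_nonsing_inv _ hdMt
  have hMM' : Mᵀ⁻¹ * Mᵀ = 1 := Matrix.nonsing_inv_mul _ hdMt
  have hMN : M * M⁻¹ = 1 := Matrix.mul_nonsing_inv _ hdM
  have hMN' : M⁻¹ * M = 1 := Matrix.nonsing_inv_mul _ hdM
  have hD : Matrix.diagonal l = Uᵀ * (M * B * Mᵀ) * U := by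
    rw [hs]
    calc Matrix.diagonal l = (Uᵀ * U) * Matrix.diagonal l * (Uᵀ * U) := by simp [hUU']
      _ = _ := by simp only [Matrix.mul_assoc]
  have hQ : (Uᵀ * Mᵀ⁻¹)ᵀ = M⁻¹ * U := by
    rw [Matrix.transpose_mul, Matrix.transpose_transpose, ← Matrix.transpose_nonsing_inv,
      Matrix.transpose_transpose]
  refine ⟨Uᵀ * Mᵀ⁻¹, l, ?_, ?_, ?_, ?_⟩
  · rw [hM, hQ]
    calc Uᵀ * Mᵀ⁻¹ * (Mᵀ * M) * (M⁻¹ * U) = Uᵀ * ((Mᵀ⁻¹ * Mᵀ) * (M * M⁻¹)) * U := by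
          simp only [Matrix.mul_assoc]
      _ = 1 := by simp [hMM', hMN, hUU']
  · intro z
    have hB' : B = (Uᵀ * Mᵀ⁻¹)ᵀ * Matrix.diagonal l * (Uᵀ * Mᵀ⁻¹) := by
      rw [hQ, hD]
      calc B = (M⁻¹ * M) * B * (Mᵀ * Mᵀ⁻¹) := by simp [hMM, hMN']
        _ = M⁻¹ * (U * Uᵀ) * M * B * Mᵀ * (U * Uᵀ) * Mᵀ⁻¹ := by
          simp [hUU, Matrix.mul_assoc]
        _ = _ := by simp only [Matrix.mul_assoc]
    conv_lhs => rw [hB', ← Matrix.mulVec_mulVec, ← Matrix.mulVec_mulVec, Matrix.dotProduct_mulVec,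
      Matrix.vecMul_transpose]
    simp only [dotProduct, Matrix.mulVec_diagonal]
    exact Finset.sum_congr rfl fun i _ => by ring
  · rw [← Matrix.trace_diagonal, hD, Matrix.trace_mul_comm, ← Matrix.mul_assoc, hUU,
      Matrix.one_mul, Matrix.trace_mul_comm, ← Matrix.mul_assoc, hM]
  · have : ∑ i, l i ^ 2 = (Matrix.diagonal l * Matrix.diagonal l).trace := by
      rw [Matrix.diagonal_mul_diagonal, Matrix.trace_diagonal]
      exact Finset.sum_congr rfl fun i _ => by ring
    rw [this, hD, hM]
    calc (Uᵀ * (M * B * Mᵀ) * U * (Uᵀ * (M * B * Mᵀ) * U)).trace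
        = (Uᵀ * (M * B * Mᵀ * (U * Uᵀ) * (M * B * Mᵀ) * U)).trace := by
          simp only [Matrix.mul_assoc]
      _ = (M * B * Mᵀ * (M * B * Mᵀ)).trace := by
          rw [Matrix.trace_mul_comm, hUU, Matrix.mul_one, Matrix.mul_assoc, hUU, Matrix.mul_one]
      _ = (M * (B * Mᵀ * (M * B * Mᵀ))).trace := by simp only [Matrix.mul_assoc]
      _ = _ := by rw [Matrix.trace_mul_comm]; simp only [Matrix.mul_assoc]

end Divergence

/-! ### Perturbed grids and the window function -/

section Grid

variable {d : ℕ}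

/-- The points `s i` lie in the cubes of radius `τ` around the grid points `v i`. -/
def NearGrid (τ : ℝ) (v : ℕ → Fin d → ℕ) (s : ℕ → Euc d) : Prop :=
  ∀ i c, |s i c - v i c| ≤ τ

theorem nearGrid_perturbedGrid {τ : ℝ} (hτ : 0 ≤ τ) (v : ℕ → Fin d → ℕ) {x : ℕ → Euc d}
    (hx : ∀ i, x i ∈ cube d) : NearGrid τ v (perturbedGrid τ v x) := by
  intro i c
  have h := hx i c
  simp only [perturbedGrid, PiLp.add_apply, PiLp.smul_apply, smul_eq_mul, add_sub_cancel_left]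
  rw [abs_mul, abs_of_nonneg hτ]
  have := abs_le.2 h
  nlinarith

/-- Mapping the first `I ^ d` indices onto `I ^ d` grid points, a grid enumeration is injective. -/
theorem IsGridEnumeration.injective {v : ℕ → Fin d → ℕ} (hd : 0 < d) (hv : IsGridEnumeration v) :
    Function.Injective v := by
  have key : ∀ I : ℕ, Set.InjOn v (Set.Iio (I ^ d)) := by
    intro I
    have h1 : (v '' Set.Iio (I ^ d)).ncard = (Set.Iio (I ^ d)).ncard := by
      rw [hv I]
      have e : {w : Fin d → ℕ | ∀ j, 1 ≤ w j ∧ w j ≤ I}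
          = (Fintype.piFinset (fun _ : Fin d => Finset.Icc 1 I) : Finset (Fin d → ℕ)) := by
        ext w; simp [Set.mem_Icc, Pi.le_def, forall_and]
      rw [e, Set.ncard_coe_finset, Fintype.card_piFinset]
      simp [Set.ncard_eq_toFinset_card']
    exact Set.injOn_of_ncard_image_eq h1 (Set.finite_Iio _)
  intro i j hij
  have hlt : ∀ m : ℕ, m ≤ i ⊔ j → m < (i ⊔ j + 1) ^ d := fun m hm =>
    (Nat.lt_succ_of_le hm).trans_le (Nat.le_self_pow hd.ne' _)
  exact key (i ⊔ j + 1) (hlt i (le_max_left _ _)) (hlt j (le_max_right _ _)) hij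

/-- Sums over the points of a grid enumeration are dominated by sums over a box of the lattice. -/
theorem sum_le_sum_piFinset_of_injective {v : ℕ → Fin d → ℕ} (hv : Function.Injective v) {n : ℕ}
    (i : Fin n) (D : Finset (Fin n)) (B : Finset ℤ) (hB : ∀ j ∈ D, ∀ c, (v i c : ℤ) - v j c ∈ B)
    {F : (Fin d → ℤ) → ℝ} (hF : ∀ m, 0 ≤ F m) :
    ∑ j ∈ D, F (fun c => (v i c : ℤ) - v j c) ≤ ∑ m ∈ Fintype.piFinset (fun _ => B), F m := by
  classical
  have hinj : Set.InjOn (fun j : Fin n => fun c => (v i c : ℤ) - v j c) D := by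
    intro j _ j' _ h
    apply Fin.ext
    apply hv
    funext c
    have := congrFun h c
    simp only at this
    omega
  rw [← Finset.sum_image (f := F) hinj]
  refine Finset.sum_le_sum_of_subset_of_nonneg ?_ fun m _ _ => hF m
  intro m hm
  obtain ⟨j, hj, rfl⟩ := Finset.mem_image.1 hm
  exact Fintype.mem_piFinset.2 fun c => hB j hj c

theorem NearGrid.abs_sub_sub_le {τ : ℝ} {v : ℕ → Fin d → ℕ} {s : ℕ → Euc d}
    (hs : NearGrid τ v s) (i j : ℕ) (c : Fin d) :
    |(s i - s j) c - (((v i c : ℤ) - v j c : ℤ) : ℝ)| ≤ 2 * τ := by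
  have h1 := abs_le.1 (hs i c)
  have h2 := abs_le.1 (hs j c)
  push_cast
  rw [PiLp.sub_apply, abs_le]
  constructor <;> linarith

/-- A ball contains a bounded number of points, uniformly over centres and perturbations. -/
theorem exists_card_ball_le {v : ℕ → Fin d → ℕ} (hv : Function.Injective v) {τ : ℝ}
    (ρ : ℝ) : ∃ M : ℕ, ∀ s, NearGrid τ v s → ∀ n, ∀ i : Fin n,
      (Finset.univ.filter fun j : Fin n => ‖s i - s j‖ ≤ ρ).card ≤ M := by
  set N : ℤ := ⌈ρ + 2 * τ⌉ with hN
  refine ⟨(Fintype.piFinset (fun _ : Fin d => Finset.Icc (-N) N)).card, fun s hs n i => ?_⟩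
  have := sum_le_sum_piFinset_of_injective hv i
    (Finset.univ.filter fun j : Fin n => ‖s i - s j‖ ≤ ρ) (Finset.Icc (-N) N) ?_
    (F := fun _ => 1) (fun _ => zero_le_one)
  · simp only [Finset.sum_const, nsmul_eq_mul, mul_one] at this
    exact_mod_cast this
  · intro j hj c
    have h1 := abs_le.1 (hs.abs_sub_sub_le i j c)
    have h2 : |(s i - s j) c| ≤ ρ :=
      (PiLp.norm_apply_le (s i - s j) c).trans (Finset.mem_filter.1 hj).2
    have h2' := abs_le.1 h2
    have h3 := Int.le_ceil (ρ + 2 * τ)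
    rw [Finset.mem_Icc]
    constructor
    · have : -(N : ℝ) ≤ (((v i c : ℤ) - v j c : ℤ) : ℝ) := by linarith
      exact_mod_cast this
    · have : (((v i c : ℤ) - v j c : ℤ) : ℝ) ≤ N := by linarith
      exact_mod_cast this

/-- The function on the integers with value `1` at `0` and `δ / m²` at `m ≠ 0`. -/
def latticeDecay (δ : ℝ) (m : ℤ) : ℝ := if m = 0 then 1 else δ / (m : ℝ) ^ 2

theorem latticeDecay_nonneg {δ : ℝ} (hδ : 0 ≤ δ) (m : ℤ) : 0 ≤ latticeDecay δ m := by
  unfold latticeDecay; split_ifs <;> positivity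

theorem sum_latticeDecay_le {δ : ℝ} (hδ : 0 ≤ δ) (B : Finset ℤ) :
    ∑ m ∈ B, latticeDecay δ m ≤ 1 + δ * ∑' m : ℤ, 1 / (m : ℝ) ^ 2 := by
  have hsum : Summable fun m : ℤ => 1 / (m : ℝ) ^ 2 :=
    Real.summable_one_div_int_pow.2 one_lt_two
  calc ∑ m ∈ B, latticeDecay δ m ≤ ∑ m ∈ B, ((if m = 0 then 1 else 0) + δ * (1 / (m : ℝ) ^ 2)) := by
        refine Finset.sum_le_sum fun m _ => ?_
        unfold latticeDecay
        split_ifs with h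
        · simp [h]
        · rw [zero_add, mul_one_div]
    _ = ∑ m ∈ B, (if m = 0 then (1 : ℝ) else 0) + δ * ∑ m ∈ B, 1 / (m : ℝ) ^ 2 := by
        rw [Finset.sum_add_distrib, Finset.mul_sum]
    _ ≤ _ := by
        gcongr
        · rw [Finset.sum_ite_eq']
          split_ifs <;> norm_num
        · exact hsum.sum_le_tsum _ fun m _ => by positivity

/-- The off-diagonal row sums of a kernel with product decay are at most `1 / 2`, if the decay
constant `δ` is small. -/
theorem exists_offDiag_sum_le_half {v : ℕ → Fin d → ℕ} (hv : Function.Injective v) :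
    ∃ δ > 0, ∀ n, ∀ i : Fin n, ∑ j ∈ Finset.univ.erase i,
      ∏ c, latticeDecay δ ((v i c : ℤ) - v j c) ≤ 1 / 2 := by
  classical
  set S₀ : ℝ := ∑' m : ℤ, 1 / (m : ℝ) ^ 2 
  obtain ⟨δ, hδ, hδ'⟩ : ∃ δ > 0, (1 + δ * S₀) ^ d < 3 / 2 := by
    have hc : Tendsto (fun δ : ℝ => (1 + δ * S₀) ^ d) (𝓝[>] 0) (𝓝 ((1 + 0 * S₀) ^ d)) :=
      (Continuous.tendsto (by fun_prop) 0).mono_left nhdsWithin_le_nhds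
    have := (hc.eventually_lt_const (u := 3 / 2) (by norm_num)).and self_mem_nhdsWithin
    obtain ⟨δ, h1, h2⟩ := this.exists
    exact ⟨δ, h2, h1⟩
  refine ⟨δ, hδ, fun n i => ?_⟩
  set B : Finset ℤ := Finset.univ.biUnion fun j : Fin n =>
    Finset.univ.image fun c => (v i c : ℤ) - v j c with hB
  have h1 := sum_le_sum_piFinset_of_injective hv i Finset.univ B
    (fun j _ c => Finset.mem_biUnion.2 ⟨j, Finset.mem_univ _, Finset.mem_image_of_mem _
      (Finset.mem_univ _)⟩) (F := fun m => ∏ c, latticeDecay δ (m c))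
    (fun m => Finset.prod_nonneg fun c _ => latticeDecay_nonneg hδ.le _)
  -- the sum over the whole box is a `d`-th power, and the diagonal term is `1`
  rw [← Finset.add_sum_erase _ _ (Finset.mem_univ i),
    ← Finset.prod_univ_sum (fun _ => B) fun _ m => latticeDecay δ m] at h1
  have h2 : ∏ _c : Fin d, ∑ m ∈ B, latticeDecay δ m ≤ (1 + δ * S₀) ^ d := by
    rw [Finset.prod_const, Finset.card_univ, Fintype.card_fin]
    exact pow_le_pow_left₀ (Finset.sum_nonneg fun m _ => latticeDecay_nonneg hδ.le m)
      (sum_latticeDecay_le hδ.le B) d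
  have h3 : ∏ c, latticeDecay δ ((v i c : ℤ) - v i c) = 1 := by simp [latticeDecay]
  rw [h3] at h1
  linarith

end Grid

section Window

/-- The window `(ρ² - x²)₊` on the line, as an indicator of a half-open interval to suit interval
integrals. -/
def window (ρ x : ℝ) : ℝ := (Set.Ioc (-ρ) ρ).indicator (fun x => ρ ^ 2 - x ^ 2) x

theorem window_nonneg {ρ : ℝ} (x : ℝ) : 0 ≤ window ρ x := by
  unfold window
  refine Set.indicator_nonneg (fun x hx => ?_) x
  nlinarith [hx.1, hx.2]

theorem window_le {ρ : ℝ} (x : ℝ) : window ρ x ≤ ρ ^ 2 := by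
  unfold window
  refine Set.indicator_le' (g := fun _ => ρ ^ 2) (fun x _ => ?_) (fun x _ => by positivity) x
  nlinarith [sq_nonneg x]

theorem window_eq_zero {ρ x : ℝ} (h : ρ < |x|) : window ρ x = 0 := by
  refine Set.indicator_of_notMem (fun hx => ?_) _
  exact absurd (abs_le.2 ⟨hx.1.le, hx.2⟩) (not_le.2 h)

theorem integrable_window (ρ : ℝ) : Integrable (window ρ) := by
  unfold window
  refine IntegrableOn.integrable_indicator ?_ measurableSet_Ioc
  exact (Continuous.integrableOn_Icc (by fun_prop)).mono_set Set.Ioc_subset_Icc_self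

theorem integral_window {ρ : ℝ} (hρ : 0 < ρ) : ∫ x, window ρ x = 4 / 3 * ρ ^ 3 := by
  unfold window
  rw [integral_indicator measurableSet_Ioc, ← intervalIntegral.integral_of_le (by linarith),
    intervalIntegral.integral_sub (by simp) (by simp)]
  simp
  ring

/-- The Fourier transform of the window. -/
def windowFourier (ρ y : ℝ) : ℂ := ∫ x, (window ρ x : ℂ) * Complex.exp (Complex.I * (x * y : ℝ))

theorem norm_windowFourier_le {ρ : ℝ} (hρ : 0 < ρ) (y : ℝ) :
    ‖windowFourier ρ y‖ ≤ 4 / 3 * ρ ^ 3 := by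
  rw [← integral_window hρ]
  refine (norm_integral_le_integral_norm _).trans (le_of_eq ?_)
  congr 1
  funext x
  rw [norm_mul, mul_comm Complex.I, Complex.norm_exp_ofReal_mul_I, mul_one, Complex.norm_real,
    Real.norm_of_nonneg (window_nonneg x)]

/-- Quadratic decay of the Fourier transform: the window vanishes at `±ρ`, so the boundary term of
order `1 / y` in the repeated integration by parts is zero. -/
theorem norm_windowFourier_le_of_ne_zero {ρ y : ℝ} (hρ : 0 < ρ) (hy : y ≠ 0) :
    ‖windowFourier ρ y‖ ≤ 4 * ρ / y ^ 2 + 4 / |y| ^ 3 := by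
  have hy' : (y : ℂ) ≠ 0 := by exact_mod_cast hy
  -- an antiderivative of the integrand
  set G : ℝ → ℂ := fun x => Complex.exp (Complex.I * (x * y : ℝ)) *
    (((ρ : ℂ) ^ 2 - x ^ 2) / (Complex.I * y) - 2 * x / y ^ 2 - 2 * Complex.I / y ^ 3) with hG
  have hI : Complex.I ^ 2 = -1 := Complex.I_sq
  have hderiv : ∀ x : ℝ, HasDerivAt G
      (((ρ : ℂ) ^ 2 - x ^ 2) * Complex.exp (Complex.I * (x * y : ℝ))) x := by
    intro x
    have h0 : HasDerivAt (fun x : ℝ => (x : ℂ)) 1 x := Complex.ofRealCLM.hasDerivAt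
    have h1 : HasDerivAt (fun x : ℝ => Complex.exp (Complex.I * (x * y : ℝ)))
        (Complex.exp (Complex.I * (x * y : ℝ)) * (Complex.I * y)) x := by
      have := ((h0.mul_const (y : ℂ)).const_mul Complex.I).cexp
      simpa using this
    have h2 : HasDerivAt (fun x : ℝ => ((ρ : ℂ) ^ 2 - (x : ℂ) ^ 2) / (Complex.I * y)
        - 2 * x / y ^ 2 - 2 * Complex.I / y ^ 3)
        ((-(2 * x)) / (Complex.I * y) - 2 / y ^ 2) x := by
      have ha := ((h0.pow 2).const_sub ((ρ : ℂ) ^ 2)).div_const (Complex.I * y)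
      have hb := (h0.const_mul (2 : ℂ)).div_const ((y : ℂ) ^ 2)
      have := (ha.sub hb).sub_const (2 * Complex.I / (y : ℂ) ^ 3)
      exact this.congr_deriv (by simp)
    refine (h1.mul h2).congr_deriv ?_
    field_simp
    linear_combination (-2 * Complex.I - 2 * x * y) * hI
  have hint : windowFourier ρ y = G ρ - G (-ρ) := by
    have hcont : Continuous fun x : ℝ =>
        ((ρ : ℂ) ^ 2 - x ^ 2) * Complex.exp (Complex.I * (x * y : ℝ)) := by fun_prop
    rw [← intervalIntegral.integral_eq_sub_of_hasDerivAt (fun x _ => hderiv x)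
      (hcont.intervalIntegrable _ _), intervalIntegral.integral_of_le (by linarith),
      ← integral_indicator measurableSet_Ioc, windowFourier]
    congr 1
    funext x
    unfold window
    by_cases hx : x ∈ Set.Ioc (-ρ) ρ
    · simp [hx]
    · simp [hx]
  have hbound : ∀ x : ℝ, |x| = ρ → ‖G x‖ ≤ 2 * ρ / y ^ 2 + 2 / |y| ^ 3 := by
    intro x hx
    have hx2 : (x : ℂ) ^ 2 = (ρ : ℂ) ^ 2 := by
      rw [← hx]; norm_cast; rw [sq_abs]
    have e : G x = Complex.exp ((x * y : ℝ) * Complex.I)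
        * (-(2 * x / y ^ 2) - 2 * Complex.I / y ^ 3) := by
      rw [hG]
      simp only [hx2, mul_comm Complex.I ((x * y : ℝ) : ℂ)]
      congr 1
      ring
    rw [e, norm_mul, Complex.norm_exp_ofReal_mul_I, one_mul]
    refine (norm_sub_le _ _).trans (le_of_eq ?_)
    simp [hx]
  rw [hint]
  refine (norm_sub_le _ _).trans ?_
  have h1 := hbound ρ (abs_of_pos hρ)
  have h2 := hbound (-ρ) (by rw [abs_neg, abs_of_pos hρ])
  calc _ ≤ (2 * ρ / y ^ 2 + 2 / |y| ^ 3) + (2 * ρ / y ^ 2 + 2 / |y| ^ 3) := by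
        exact add_le_add h1 h2
    _ = _ := by ring

/-- For a wide window, the normalized Fourier transform at a point within `2τ < 1` of the integer
`m` is dominated by `latticeDecay δ m`. -/
theorem exists_windowFourier_le_latticeDecay {τ δ : ℝ} (hτ : τ < 1 / 2) (hτ0 : 0 ≤ τ)
    (hδ : 0 < δ) : ∃ ρ > 0, ∀ (y : ℝ) (m : ℤ), |y - m| ≤ 2 * τ →
      ‖windowFourier ρ y‖ ≤ 4 / 3 * ρ ^ 3 * latticeDecay δ m := by
  set γ := 1 - 2 * τ with hγ
  have hγ0 : 0 < γ := by linarith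
  -- `ρ ≥ 1` is so large that `3 / (ρ γ²) + 3 / (ρ γ³) ≤ δ`
  set ρ := max 1 ((3 / γ ^ 2 + 3 / γ ^ 3) / δ) with hρ
  have hρ1 : 1 ≤ ρ := le_max_left _ _
  have hρ2 : 3 / γ ^ 2 + 3 / γ ^ 3 ≤ δ * ρ := by
    have : (3 / γ ^ 2 + 3 / γ ^ 3) / δ ≤ ρ := le_max_right _ _
    rwa [div_le_iff₀ hδ, mul_comm] at this
  have hρ0 : 0 < ρ := by linarith
  refine ⟨ρ, hρ0, fun y m hy => ?_⟩
  unfold latticeDecay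
  split_ifs with hm
  · rw [mul_one]; exact norm_windowFourier_le hρ0 y
  have hm1 : (1 : ℝ) ≤ |(m : ℝ)| := by
    rw [← Int.cast_abs]; exact_mod_cast Int.one_le_abs hm
  have hym : γ * |(m : ℝ)| ≤ |y| := by
    have := abs_sub_abs_le_abs_sub (m : ℝ) y
    rw [abs_sub_comm] at this
    nlinarith
  have hm0 : 0 < |(m : ℝ)| := by linarith
  have hy0 : 0 < |y| := (mul_pos hγ0 hm0).trans_le hym
  refine (norm_windowFourier_le_of_ne_zero hρ0 (abs_pos.1 hy0)).trans ?_
  rw [← sq_abs y, ← sq_abs (m : ℝ)]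
  set a := |(m : ℝ)| with ha
  have h2 : 4 * ρ / |y| ^ 2 ≤ 4 * ρ ^ 2 / (γ ^ 2 * a ^ 2) := by
    rw [← mul_pow]
    gcongr
    nlinarith
  have h3 : 4 / |y| ^ 3 ≤ 4 * ρ ^ 2 / (γ ^ 3 * a ^ 2) := by
    have : γ ^ 3 * a ^ 2 ≤ |y| ^ 3 := by
      calc γ ^ 3 * a ^ 2 ≤ γ ^ 3 * a ^ 3 := by gcongr; linarith
        _ = (γ * a) ^ 3 := by ring
        _ ≤ _ := by gcongr
    gcongr
    nlinarith
  calc _ ≤ 4 * ρ ^ 2 / (γ ^ 2 * a ^ 2) + 4 * ρ ^ 2 / (γ ^ 3 * a ^ 2) := add_le_add h2 h3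
    _ = 4 / 3 * ρ ^ 2 / a ^ 2 * (3 / γ ^ 2 + 3 / γ ^ 3) := by field_simp
    _ ≤ 4 / 3 * ρ ^ 2 / a ^ 2 * (δ * ρ) := by gcongr
    _ = _ := by ring

end Window

/-! ### Uniform lower bounds for covariance matrices -/

section Spectral

variable {d n : ℕ}

theorem IsUniformlyPos.le_diag {c : ℝ} {A : Matrix (Fin n) (Fin n) ℝ} (hA : IsUniformlyPos c A)
    (i : Fin n) : c ≤ A i i := by
  have := hA.le_form (Pi.single i 1)
  simpa using this

/-- Quantitative Schur product theorem: it follows from the semidefiniteness of the Hadamard product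
of `A - a` and `B`. -/
theorem IsUniformlyPos.hadamard {a b : ℝ} (ha : 0 ≤ a) (hb : 0 < b)
    {A B : Matrix (Fin n) (Fin n) ℝ} (hA : IsUniformlyPos a A) (hB : IsUniformlyPos b B) :
    IsUniformlyPos (a * b) (Matrix.of fun i j => A i j * B i j) := by
  refine ⟨?_, fun x => ?_⟩
  · ext i j
    simp [hA.isSymm.apply, hB.isSymm.apply]
  have h1 : (A - a • (1 : Matrix (Fin n) (Fin n) ℝ)).PosSemidef := by
    refine Matrix.PosSemidef.of_dotProduct_mulVec_nonneg ?_ fun y => ?_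
    · refine Matrix.IsSymm.isHermitian_real ?_
      rw [Matrix.IsSymm, Matrix.transpose_sub, hA.isSymm.eq, Matrix.transpose_smul,
        Matrix.transpose_one]
    · have := hA.le_form y
      simp only [star_trivial, Matrix.sub_mulVec, dotProduct_sub, Matrix.smul_mulVec,
        Matrix.one_mulVec, dotProduct_smul, smul_eq_mul]
      linarith
  have h2 := (h1.hadamard (hB.posDef hb).posSemidef).dotProduct_mulVec_nonneg x
  have e : Matrix.hadamard (A - a • (1 : Matrix (Fin n) (Fin n) ℝ)) B
      = Matrix.of (fun i j => A i j * B i j) - Matrix.diagonal (fun i => a * B i i) := by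
    ext i j
    by_cases hij : i = j
    · subst hij; simp [sub_mul]
    · simp [hij]
  rw [e, star_trivial, Matrix.sub_mulVec, dotProduct_sub] at h2
  have h3 : a * b * (x ⬝ᵥ x) ≤ x ⬝ᵥ Matrix.diagonal (fun i => a * B i i) *ᵥ x := by
    simp only [dotProduct, Matrix.mulVec_diagonal, Finset.mul_sum]
    refine Finset.sum_le_sum fun i _ => ?_
    have := hB.le_diag i
    have : a * b * (x i * x i) ≤ a * B i i * (x i * x i) := by
      have := mul_self_nonneg (x i)
      gcongr
    linarith
  linarith

/-- The lower bound for the quadratic form of a diagonally dominant matrix. -/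
theorem sum_sum_mul_ge_of_offDiag {w g : Fin n → Fin n → ℝ} {C : ℝ} (hC : 0 ≤ C)
    (hw : ∀ i, w i i = C) (hwg : ∀ i j, |w i j| ≤ C * g i j) (hg : ∀ i j, g i j = g j i)
    (hsum : ∀ i, ∑ j ∈ Finset.univ.erase i, g i j ≤ 1 / 2) (a : Fin n → ℝ) :
    C / 2 * ∑ i, a i ^ 2 ≤ ∑ i, ∑ j, a i * a j * w i j := by
  have h1 : ∀ i, ∑ j, a i * a j * w i j ≥ C * a i ^ 2
      - ∑ j ∈ Finset.univ.erase i, C * g i j * ((a i ^ 2 + a j ^ 2) / 2) := by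
    intro i
    rw [← Finset.add_sum_erase _ _ (Finset.mem_univ i), hw, ge_iff_le, sub_eq_add_neg,
      ← Finset.sum_neg_distrib]
    refine add_le_add (le_of_eq (by ring)) (Finset.sum_le_sum fun j _ => ?_)
    have h2 : |a i * a j * w i j| ≤ (a i ^ 2 + a j ^ 2) / 2 * (C * g i j) := by
      rw [abs_mul]
      refine mul_le_mul ?_ (hwg i j) (abs_nonneg _) (by positivity)
      rw [abs_mul, ← sq_abs (a i), ← sq_abs (a j)]
      nlinarith [sq_nonneg (|a i| - |a j|)]
    have := (abs_le.1 h2).1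
    linarith
  have h2 : ∑ i, ∑ j ∈ Finset.univ.erase i, C * g i j * ((a i ^ 2 + a j ^ 2) / 2)
      = ∑ i, C * a i ^ 2 * ∑ j ∈ Finset.univ.erase i, g i j := by
    have e1 : ∑ i, ∑ j ∈ Finset.univ.erase i, C * g i j * (a j ^ 2)
        = ∑ i, ∑ j ∈ Finset.univ.erase i, C * g i j * (a i ^ 2) := by
      rw [Finset.sum_comm' (t' := Finset.univ) (s' := fun j => Finset.univ.erase j)]
      · refine Finset.sum_congr rfl fun i _ => Finset.sum_congr rfl fun j _ => ?_
        rw [hg]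
      · intro x y; simp [eq_comm]
    calc _ = (∑ i, ∑ j ∈ Finset.univ.erase i, C * g i j * (a i ^ 2)
          + ∑ i, ∑ j ∈ Finset.univ.erase i, C * g i j * (a j ^ 2)) / 2 := by
          rw [← Finset.sum_add_distrib, Finset.sum_div]
          refine Finset.sum_congr rfl fun i _ => ?_
          rw [← Finset.sum_add_distrib, Finset.sum_div]
          exact Finset.sum_congr rfl fun j _ => by ring
      _ = ∑ i, ∑ j ∈ Finset.univ.erase i, C * g i j * (a i ^ 2) := by rw [e1]; ring
      _ = _ := by
          refine Finset.sum_congr rfl fun i _ => ?_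
          rw [Finset.mul_sum]
          exact Finset.sum_congr rfl fun j _ => by ring
  calc C / 2 * ∑ i, a i ^ 2 = ∑ i, (C * a i ^ 2 - C * a i ^ 2 * (1 / 2)) := by
        rw [Finset.mul_sum]; exact Finset.sum_congr rfl fun i _ => by ring
    _ ≤ ∑ i, (C * a i ^ 2 - C * a i ^ 2 * ∑ j ∈ Finset.univ.erase i, g i j) := by
        refine Finset.sum_le_sum fun i _ => ?_
        have := hsum i
        gcongr
    _ = ∑ i, (C * a i ^ 2
          - ∑ j ∈ Finset.univ.erase i, C * g i j * ((a i ^ 2 + a j ^ 2) / 2)) := by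
        rw [Finset.sum_sub_distrib, Finset.sum_sub_distrib, h2]
    _ ≤ _ := Finset.sum_le_sum fun i _ => h1 i

/-- The squared modulus `|∑ j, a j exp (i ⟨f, s j⟩)|²` of an exponential sum, written with real and
imaginary parts. -/
def trigSq (s : ℕ → Euc d) (a : Fin n → ℝ) (f : Euc d) : ℝ :=
  (∑ j, a j * Real.cos (inner ℝ f (s j))) ^ 2 + (∑ j, a j * Real.sin (inner ℝ f (s j))) ^ 2

theorem trigSq_eq (s : ℕ → Euc d) (a : Fin n → ℝ) (f : Euc d) :
    trigSq s a f = ∑ i, ∑ j, a i * a j * Real.cos (inner ℝ f (s i - s j)) := by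
  simp only [trigSq, sq, Finset.sum_mul_sum, ← Finset.sum_add_distrib, inner_sub_right,
    Real.cos_sub]
  exact Finset.sum_congr rfl fun i _ => Finset.sum_congr rfl fun j _ => by ring

theorem integrable_mul_cos {h : Euc d → ℝ} (hh : Integrable h) (y : Euc d) :
    Integrable fun f => h f * Real.cos (inner ℝ f y) :=
  hh.mul_bdd (c := 1) (Continuous.aestronglyMeasurable (by fun_prop))
    (Eventually.of_forall fun f => by simpa using Real.abs_cos_le_one _)

theorem integrable_mul_trigSq {h : Euc d → ℝ} (hh : Integrable h) (s : ℕ → Euc d)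
    (a : Fin n → ℝ) : Integrable fun f => h f * trigSq s a f := by
  simp only [trigSq_eq, Finset.mul_sum]
  refine integrable_finsetSum _ fun i _ => integrable_finsetSum _ fun j _ => ?_
  exact ((integrable_mul_cos hh (s i - s j)).const_mul (a i * a j)).congr
    (Eventually.of_forall fun f => by ring)

theorem integral_mul_trigSq {h : Euc d → ℝ} (hh : Integrable h) (s : ℕ → Euc d)
    (a : Fin n → ℝ) : ∫ f, h f * trigSq s a f
      = ∑ i, ∑ j, a i * a j * ∫ f, h f * Real.cos (inner ℝ f (s i - s j)) := by
  have hi : ∀ i j, Integrable fun f => a i * a j * (h f * Real.cos (inner ℝ f (s i - s j))) :=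
    fun i j => (integrable_mul_cos hh (s i - s j)).const_mul (a i * a j)
  have e : (fun f => h f * trigSq s a f) = fun f => ∑ i, ∑ j,
      a i * a j * (h f * Real.cos (inner ℝ f (s i - s j))) := by
    funext f
    simp only [trigSq_eq, Finset.mul_sum]
    exact Finset.sum_congr rfl fun i _ => Finset.sum_congr rfl fun j _ => by ring
  rw [e, integral_finsetSum _ fun i _ => integrable_finsetSum _ fun j _ => hi i j]
  refine Finset.sum_congr rfl fun i _ => ?_
  rw [integral_finsetSum _ fun j _ => hi i j]
  exact Finset.sum_congr rfl fun j _ => integral_const_mul _ _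

theorem integral_mul_cos_eq_re {h : Euc d → ℝ} (hh : Integrable h) (y : Euc d) :
    ∫ f, h f * Real.cos (inner ℝ f y)
      = (∫ f, (h f : ℂ) * Complex.exp (Complex.I * (inner ℝ f y : ℝ))).re := by
  have hint : Integrable fun f => (h f : ℂ) * Complex.exp (Complex.I * (inner ℝ f y : ℝ)) := by
    refine hh.ofReal.mul_bdd (c := 1) (Continuous.aestronglyMeasurable (by fun_prop))
      (Eventually.of_forall fun f => ?_)
    rw [mul_comm, Complex.norm_exp_ofReal_mul_I]
  rw [← Complex.reCLM_apply, ← Complex.reCLM.integral_comp_comm hint]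
  congr 1
  funext f
  rw [Complex.reCLM_apply, Complex.re_ofReal_mul, mul_comm Complex.I, Complex.exp_ofReal_mul_I_re]

/-- The product over the coordinates of the windows `(ρ² - f_c²)₊`. -/
def windowProd (d : ℕ) (ρ : ℝ) (f : Euc d) : ℝ := ∏ c, window ρ (f c)

theorem integrable_windowProd (ρ : ℝ) : Integrable (windowProd d ρ) := by
  have h := Integrable.fintype_prod (f := fun (_ : Fin d) x => window ρ x)
    (μ := fun _ => volume) fun _ => integrable_window ρ
  exact (PiLp.volume_preserving_ofLp (Fin d)).integrable_comp_of_integrable h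

theorem integral_windowProd_mul_exp (ρ : ℝ) (y : Euc d) :
    ∫ f, (windowProd d ρ f : ℂ) * Complex.exp (Complex.I * (inner ℝ f y : ℝ))
      = ∏ c, windowFourier ρ (y c) := by
  have h := integral_fintype_prod_volume_eq_prod (𝕜 := ℂ) fun (c : Fin d) (x : ℝ) =>
    (window ρ x : ℂ) * Complex.exp (Complex.I * (x * y c : ℝ))
  rw [← (PiLp.volume_preserving_ofLp (Fin d)).integral_comp
    (MeasurableEquiv.toLp 2 (Fin d → ℝ)).symm.measurableEmbedding] at h
  unfold windowFourier
  rw [← h]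
  congr 1
  funext f
  rw [Finset.prod_mul_distrib, ← Complex.exp_sum, ← Finset.mul_sum, windowProd]
  push_cast
  congr 3
  rw [PiLp.inner_apply]
  push_cast
  exact Finset.sum_congr rfl fun c _ => by simp [mul_comm]

/-- A lower Ingham-type inequality: on a large box, exponential sums with well separated
frequencies have `L²` norms bounded below by the norms of their coefficients. -/
theorem exists_integral_windowProd_mul_trigSq_ge {v : ℕ → Fin d → ℕ} (hv : Function.Injective v)
    {τ : ℝ} (hτ0 : 0 ≤ τ) (hτ : τ < 1 / 2) : ∃ ρ > 0, ∃ κ > 0, ∀ s, NearGrid τ v s →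
      ∀ (n : ℕ) (a : Fin n → ℝ),
        κ * ∑ i, a i ^ 2 ≤ ∫ f, windowProd d ρ f * trigSq s a f := by
  obtain ⟨δ, hδ, hδs⟩ := exists_offDiag_sum_le_half hv
  obtain ⟨ρ, hρ, hρδ⟩ := exists_windowFourier_le_latticeDecay hτ hτ0 hδ
  refine ⟨ρ, hρ, (4 / 3 * ρ ^ 3) ^ d / 2, by positivity, fun s hs n a => ?_⟩
  rw [integral_mul_trigSq (integrable_windowProd ρ)]
  refine sum_sum_mul_ge_of_offDiag (by positivity) (fun i => ?_) (fun i j => ?_) (fun i j => ?_)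
    (fun i => hδs n i) a
  · simp only [sub_self, inner_zero_right, Real.cos_zero, mul_one]
    have h := integral_windowProd_mul_exp (d := d) ρ 0
    have h0 : windowFourier ρ 0 = ((4 / 3 * ρ ^ 3 : ℝ) : ℂ) := by
      rw [windowFourier, ← integral_window hρ, ← integral_complex_ofReal]
      simp
    simp only [inner_zero_right, Complex.ofReal_zero, mul_zero, Complex.exp_zero, mul_one,
      PiLp.zero_apply, h0, Finset.prod_const, Finset.card_univ, Fintype.card_fin] at h
    rw [integral_complex_ofReal] at h
    exact_mod_cast h
  · rw [integral_mul_cos_eq_re (integrable_windowProd ρ), integral_windowProd_mul_exp]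
    refine (Complex.abs_re_le_norm _).trans ?_
    rw [norm_prod]
    calc _ ≤ ∏ c, (4 / 3 * ρ ^ 3 * latticeDecay δ ((v i c : ℤ) - v j c)) :=
          Finset.prod_le_prod (fun c _ => norm_nonneg _) fun c _ =>
            hρδ _ _ (hs.abs_sub_sub_le i j c)
      _ = _ := by simp [Finset.prod_mul_distrib]
  · refine Finset.prod_congr rfl fun c _ => ?_
    have e : ∀ m : ℤ, latticeDecay δ (-m) = latticeDecay δ m := by
      intro m; simp [latticeDecay]
    rw [← e, neg_sub]

/-- Fourier inversion in real form. -/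
theorem HasPositiveSpectralDensity.eq_integral_cos {p : ℕ} {Θ : Set (Euc p)}
    {c : Euc p → Euc d → ℝ} (hc : HasPositiveSpectralDensity Θ c) :
    ∃ ĉ : Euc p → Euc d → ℝ,
      ContinuousOn (fun q : Euc p × Euc d => ĉ q.1 q.2) (Θ ×ˢ Set.univ) ∧
      ∀ θ ∈ Θ, (∀ f, 0 < ĉ θ f) ∧ Integrable (ĉ θ) ∧
        ∀ s, c θ s = ∫ f, ĉ θ f * Real.cos (inner ℝ f s) := by
  obtain ⟨ĉ, h1, h2⟩ := hc
  refine ⟨ĉ, h1, fun θ hθ => ⟨(h2 θ hθ).1, (h2 θ hθ).2.1, fun s => ?_⟩⟩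
  rw [integral_mul_cos_eq_re (h2 θ hθ).2.1, ← (h2 θ hθ).2.2 s, Complex.ofReal_re]

theorem HasPositiveSpectralDensity.even {p : ℕ} {Θ : Set (Euc p)}
    {c : Euc p → Euc d → ℝ} (hc : HasPositiveSpectralDensity Θ c) {θ : Euc p} (hθ : θ ∈ Θ)
    (s : Euc d) : c θ (-s) = c θ s := by
  obtain ⟨ĉ, -, h⟩ := hc.eq_integral_cos
  simp [(h θ hθ).2.2]

theorem HasPositiveSpectralDensity.continuous {p : ℕ} {Θ : Set (Euc p)}
    {c : Euc p → Euc d → ℝ} (hc : HasPositiveSpectralDensity Θ c) {θ : Euc p} (hθ : θ ∈ Θ) :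
    Continuous (c θ) := by
  obtain ⟨ĉ, -, h⟩ := hc.eq_integral_cos
  obtain ⟨hpos, hint, hs⟩ := h θ hθ
  rw [funext hs]
  refine continuous_of_dominated (bound := fun f => ĉ θ f)
    (fun s => (integrable_mul_cos hint s).aestronglyMeasurable)
    (fun s => Eventually.of_forall fun f => ?_) hint
    (Eventually.of_forall fun f => by fun_prop)
  rw [norm_mul, Real.norm_of_nonneg (hpos f).le]
  exact mul_le_of_le_one_right (hpos f).le (Real.abs_cos_le_one _)

theorem isSymm_covMatrix {c : Euc d → ℝ} (hc : ∀ s, c (-s) = c s) (s : ℕ → Euc d) (n : ℕ) :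
    (covMatrix c s n).IsSymm := by
  ext i j
  simp only [covMatrix, Matrix.transpose_apply, Matrix.of_apply]
  rw [← hc, neg_sub]

theorem dotProduct_covMatrix_mulVec (c : Euc d → ℝ) (s : ℕ → Euc d) (a : Fin n → ℝ) :
    a ⬝ᵥ covMatrix c s n *ᵥ a = ∑ i, ∑ j, a i * a j * c (s i - s j) := by
  simp only [dotProduct, Matrix.mulVec, covMatrix, Matrix.of_apply, Finset.mul_sum]
  exact Finset.sum_congr rfl fun i _ => Finset.sum_congr rfl fun j _ => by ring

/-- Covariance matrices of a compact family with positive spectral densities are positive definite,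
uniformly over parameters, sample sizes and perturbations of the grid. -/
theorem HasPositiveSpectralDensity.exists_isUniformlyPos {p : ℕ} {Θ : Set (Euc p)}
    (hΘ : IsCompact Θ) {c : Euc p → Euc d → ℝ} (hc : HasPositiveSpectralDensity Θ c)
    {v : ℕ → Fin d → ℕ} (hv : Function.Injective v) {τ : ℝ} (hτ0 : 0 ≤ τ) (hτ : τ < 1 / 2) :
    ∃ b > 0, ∀ θ ∈ Θ, ∀ s, NearGrid τ v s → ∀ n, IsUniformlyPos b (covMatrix (c θ) s n) := by
  rcases Θ.eq_empty_or_nonempty with rfl | hne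
  · exact ⟨1, one_pos, by simp⟩
  obtain ⟨ρ, hρ, κ, hκ, hlow⟩ := exists_integral_windowProd_mul_trigSq_ge hv hτ0 hτ
  obtain ⟨ĉ, hcont, h⟩ := hc.eq_integral_cos
  -- the smallest value `c₀` of the spectral densities on the box carrying the window
  set B : Set (Euc d) := {f | ∀ i, |f i| ≤ ρ} with hB
  have hBc : IsCompact B := by
    have hpi : IsCompact (Set.univ.pi fun _ : Fin d => Set.Icc (-ρ) ρ) :=
      isCompact_univ_pi fun _ => isCompact_Icc
    have := hpi.image (PiLp.continuous_toLp 2 (fun _ : Fin d => ℝ))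
    convert this using 1
    ext f
    constructor
    · intro hf
      exact ⟨f.ofLp, fun i _ => abs_le.1 (hf i), rfl⟩
    · rintro ⟨g, hg, rfl⟩ i
      exact abs_le.2 (hg i (Set.mem_univ i))
  have hBne : B.Nonempty := ⟨0, fun i => by simp [hρ.le]⟩
  obtain ⟨q, hq, hmin⟩ := (hΘ.prod hBc).exists_isMinOn (hne.prod hBne)
    (hcont.mono (Set.prod_mono_right (Set.subset_univ B)))
  set c₀ := ĉ q.1 q.2 with hc₀
  have hc₀pos : 0 < c₀ := (h q.1 hq.1).1 q.2
  refine ⟨c₀ / (ρ ^ 2) ^ d * κ, by positivity, fun θ hθ s hs n =>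
    ⟨isSymm_covMatrix (hc.even hθ) s n, fun a => ?_⟩⟩
  obtain ⟨hpos, hint, hcos⟩ := h θ hθ
  rw [dotProduct_covMatrix_mulVec]
  simp only [hcos]
  rw [← integral_mul_trigSq hint]
  have hmono : ∫ f, (c₀ / (ρ ^ 2) ^ d * windowProd d ρ f) * trigSq s a f
      ≤ ∫ f, ĉ θ f * trigSq s a f := by
    refine integral_mono (integrable_mul_trigSq ((integrable_windowProd ρ).const_mul _) s a)
      (integrable_mul_trigSq hint s a) fun f => ?_
    have hq0 : 0 ≤ trigSq s a f := by unfold trigSq; positivity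
    refine mul_le_mul_of_nonneg_right ?_ hq0
    by_cases hf : f ∈ B
    · have h1 : c₀ ≤ ĉ θ f := hmin (Set.mk_mem_prod hθ hf)
      have h2 : windowProd d ρ f ≤ (ρ ^ 2) ^ d := by
        calc windowProd d ρ f ≤ ∏ _c : Fin d, ρ ^ 2 :=
              Finset.prod_le_prod (fun c _ => window_nonneg _) fun c _ => window_le _
          _ = _ := by simp
      calc c₀ / (ρ ^ 2) ^ d * windowProd d ρ f ≤ c₀ / (ρ ^ 2) ^ d * (ρ ^ 2) ^ d := by gcongr
        _ = c₀ := by field_simp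
        _ ≤ _ := h1
    · simp only [hB, Set.mem_ofPred_eq, not_forall, not_le] at hf
      obtain ⟨i, hi⟩ := hf
      rw [windowProd, Finset.prod_eq_zero (Finset.mem_univ i) (window_eq_zero hi), mul_zero]
      exact (hpos f).le
  refine le_trans ?_ hmono
  simp only [mul_assoc]
  rw [integral_const_mul]
  have e : a ⬝ᵥ a = ∑ i, a i ^ 2 := by simp [dotProduct, pow_two]
  rw [e]
  exact mul_le_mul_of_nonneg_left (hlow s hs n a) (by positivity)

end Spectral

/-! ### Covariance matrices of decaying and tapered families -/

section Families

open scoped Matrix.Norms.L2Operator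

variable {d p : ℕ}

/-- Changing a compactly supported covariance function by at most `ε` changes the covariance
matrices by at most a constant multiple of `ε` in operator norm. -/
theorem exists_opNorm_covMatrix_sub_le {v : ℕ → Fin d → ℕ} (hv : Function.Injective v) (τ C : ℝ) :
    ∃ M : ℕ, ∀ s, NearGrid τ v s → ∀ (n : ℕ) (g g' : Euc d → ℝ) (ε : ℝ), 0 ≤ ε →
      (∀ y, g (-y) = g y) → (∀ y, g' (-y) = g' y) → (∀ y, C < ‖y‖ → g y = g' y) →
      (∀ y, |g y - g' y| ≤ ε) → ‖covMatrix g s n - covMatrix g' s n‖ ≤ M * ε := by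
  obtain ⟨M, hM⟩ := exists_card_ball_le hv (τ := τ) C
  refine ⟨M, fun s hs n g g' ε hε hg hg' hC hgg => ?_⟩
  have hsymm : (covMatrix g s n - covMatrix g' s n).IsSymm := by
    rw [Matrix.IsSymm, Matrix.transpose_sub, (isSymm_covMatrix hg s n).eq,
      (isSymm_covMatrix hg' s n).eq]
  refine opNorm_le_of_rowSum_le hsymm (by positivity) fun i => ?_
  calc ∑ j : Fin n, |(covMatrix g s n - covMatrix g' s n) i j|
      ≤ ∑ j : Fin n, (if ‖s i - s j‖ ≤ C then ε else 0) := by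
        refine Finset.sum_le_sum fun j _ => ?_
        simp only [Matrix.sub_apply, covMatrix, Matrix.of_apply]
        split_ifs with h
        · exact hgg _
        · rw [hC _ (not_le.1 h), sub_self, abs_zero]
    _ = (Finset.univ.filter fun j : Fin n => ‖s i - s j‖ ≤ C).card * ε := by
        rw [← Finset.sum_filter, Finset.sum_const, nsmul_eq_mul]
    _ ≤ M * ε := by
        have := hM s hs n i
        gcongr

/-- If the covariance function vanishes at infinity, the squared Frobenius norms of the `n × n`
covariance matrices are `o(n²)`, uniformly over the perturbations. -/
theorem eventually_sum_sq_covMatrix_le {v : ℕ → Fin d → ℕ} (hv : Function.Injective v) (τ : ℝ)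
    {c : Euc d → ℝ} {A : ℝ} (hA : ∀ y, |c y| ≤ A)
    (hc : ∀ η > 0, ∃ ρ, ∀ y, ρ < ‖y‖ → |c y| ≤ η) {ε : ℝ} (hε : 0 < ε) :
    ∀ᶠ n : ℕ in atTop, ∀ s, NearGrid τ v s →
      ∑ i, ∑ j, covMatrix c s n i j ^ 2 ≤ ε * (n : ℝ) ^ 2 := by
  obtain ⟨ρ, hρ⟩ := hc (√(ε / 2)) (by positivity)
  obtain ⟨M, hM⟩ := exists_card_ball_le hv (τ := τ) ρ
  have hlarge : ∀ᶠ n : ℕ in atTop, M * A ^ 2 ≤ ε / 2 * n :=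
    (tendsto_natCast_atTop_atTop.const_mul_atTop (by positivity)).eventually_ge_atTop _
  filter_upwards [hlarge] with n hn s hs
  have row : ∀ i, ∑ j, covMatrix c s n i j ^ 2 ≤ ε * n := by
    intro i
    calc ∑ j, covMatrix c s n i j ^ 2
        ≤ ∑ j : Fin n, ((if ‖s i - s j‖ ≤ ρ then A ^ 2 else 0) + ε / 2) := by
          refine Finset.sum_le_sum fun j _ => ?_
          simp only [covMatrix, Matrix.of_apply]
          rw [← sq_abs]
          split_ifs with h
          · have := pow_le_pow_left₀ (abs_nonneg _) (hA (s i - s j)) 2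
            linarith
          · have := pow_le_pow_left₀ (abs_nonneg _) (hρ _ (not_le.1 h)) 2
            rw [Real.sq_sqrt (by positivity)] at this
            linarith
      _ = (Finset.univ.filter fun j : Fin n => ‖s i - s j‖ ≤ ρ).card * A ^ 2 + n * (ε / 2) := by
          rw [Finset.sum_add_distrib, ← Finset.sum_filter, Finset.sum_const, Finset.sum_const,
            Finset.card_univ, Fintype.card_fin, nsmul_eq_mul, nsmul_eq_mul]
      _ ≤ M * A ^ 2 + n * (ε / 2) := by
          have := hM s hs n i
          gcongr
      _ ≤ ε * n := by linarith
  calc _ ≤ ∑ _i : Fin n, ε * n := Finset.sum_le_sum fun i _ => row i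
    _ = _ := by rw [Finset.sum_const, Finset.card_univ, Fintype.card_fin, nsmul_eq_mul]; ring

theorem IsDecayingFamily.exists_abs_le {Θ : Set (Euc p)} {k : Euc p → Euc d → ℝ}
    (hk : IsDecayingFamily Θ k) : ∃ A, 0 ≤ A ∧ ∀ θ ∈ Θ, ∀ s, |k θ s| ≤ A := by
  obtain ⟨k', A, α, hα, -, -, h⟩ := hk.smooth_decay
  refine ⟨|A|, abs_nonneg A, fun θ hθ s => (h θ hθ s).1.trans ?_⟩
  have : 0 ≤ ‖s‖ ^ ((d : ℝ) + α) := by positivity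
  rw [div_le_iff₀ (by positivity)]
  nlinarith [le_abs_self A, abs_nonneg A]

theorem IsDecayingFamily.tendsto_zero {Θ : Set (Euc p)} {k : Euc p → Euc d → ℝ}
    (hk : IsDecayingFamily Θ k) {θ : Euc p} (hθ : θ ∈ Θ) {η : ℝ} (hη : 0 < η) :
    ∃ ρ, ∀ y, ρ < ‖y‖ → |k θ y| ≤ η := by
  obtain ⟨k', A, α, hα, -, -, h⟩ := hk.smooth_decay
  have hd : 0 < (d : ℝ) + α := by positivity
  have hlim := ((tendsto_rpow_atTop hd).const_mul_atTop hη).eventually_ge_atTop A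
  obtain ⟨ρ, hρ⟩ := eventually_atTop.1 hlim
  refine ⟨ρ, fun y hy => (h θ hθ y).1.trans ?_⟩
  have : 0 ≤ ‖y‖ ^ ((d : ℝ) + α) := by positivity
  rw [div_le_iff₀ (by positivity)]
  linarith [hρ _ hy.le]

theorem opNorm_le_sum_abs_single (f : Euc p →L[ℝ] ℝ) :
    ‖f‖ ≤ ∑ i, |f (EuclideanSpace.single i 1)| := by
  refine f.opNorm_le_bound (Finset.sum_nonneg fun i _ => abs_nonneg _) fun x => ?_
  have hx : x = ∑ i, x i • EuclideanSpace.single i (1 : ℝ) := by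
    have := (EuclideanSpace.basisFun (Fin p) ℝ).sum_repr x
    simpa using this.symm
  have e : f x = ∑ i, x i * f (EuclideanSpace.single i 1) := by
    conv_lhs => rw [hx]
    rw [map_sum]
    exact Finset.sum_congr rfl fun i _ => by rw [map_smul, smul_eq_mul]
  rw [e, Finset.sum_mul]
  refine (Finset.abs_sum_le_sum_abs _ _).trans (Finset.sum_le_sum fun i _ => ?_)
  rw [abs_mul, mul_comm]
  gcongr
  exact PiLp.norm_apply_le x i

theorem IsDecayingFamily.exists_lipschitz {Θ : Set (Euc p)} (hΘ : Convex ℝ Θ)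
    {k : Euc p → Euc d → ℝ} (hk : IsDecayingFamily Θ k) :
    ∃ L, 0 ≤ L ∧ ∀ θ ∈ Θ, ∀ θ' ∈ Θ, ∀ s, |k θ s - k θ' s| ≤ L * ‖θ - θ'‖ := by
  obtain ⟨k', A, α, hα, hder, -, h⟩ := hk.smooth_decay
  refine ⟨p * |A|, by positivity, fun θ hθ θ' hθ' s => ?_⟩
  refine hΘ.norm_image_sub_le_of_norm_hasFDerivWithin_le (hder s) (fun η hη => ?_) hθ' hθ
  refine (opNorm_le_sum_abs_single _).trans ?_
  calc _ ≤ ∑ _i : Fin p, |A| := by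
        refine Finset.sum_le_sum fun i _ => ((h η hη s).2 i).trans ?_
        have : 0 ≤ ‖s‖ ^ ((d : ℝ) + α) := by positivity
        rw [div_le_iff₀ (by positivity)]
        nlinarith [le_abs_self A, abs_nonneg A]
    _ = _ := by simp

theorem trace_covMatrix (c : Euc d → ℝ) (s : ℕ → Euc d) (n : ℕ) :
    (covMatrix c s n).trace = n * c 0 := by
  simp [Matrix.trace, covMatrix]

theorem IsUniformlyPos.covMatrix_mul {a b : ℝ} (ha : 0 ≤ a) (hb : 0 < b) {c t : Euc d → ℝ}
    {s : ℕ → Euc d} {n : ℕ} (hc : IsUniformlyPos a (covMatrix c s n))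
    (ht : IsUniformlyPos b (covMatrix t s n)) :
    IsUniformlyPos (a * b) (covMatrix (fun y => c y * t y) s n) :=
  hc.hadamard ha hb ht

/-- The tapered covariance matrices and their approximations are close in operator norm. -/
theorem eventually_opNorm_covMatrix_taper_sub_le {l : ℕ} {Θ : Set (Euc p)}
    {k : Euc p → Euc d → ℝ} (hk : IsDecayingFamily Θ k) {T : Set (Euc l)}
    {t : Euc l → Euc d → ℝ} {t' : Fin l → Euc l → Euc d → ℝ} (ht : IsTaperFamily T t t')
    {tm : ℕ → Euc l → Euc d → ℝ} {tm' : ℕ → Fin l → Euc l → Euc d → ℝ}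
    (htm : IsTaperApproximation T t t' tm tm') {η : Euc l} (hη : η ∈ T)
    {v : ℕ → Fin d → ℕ} (hv : Function.Injective v) (τ : ℝ) {ε : ℝ} (hε : 0 < ε) :
    ∀ᶠ m in atTop, ∀ θ ∈ Θ, ∀ s, NearGrid τ v s → ∀ n,
      ‖covMatrix (fun y => k θ y * t η y) s n - covMatrix (fun y => k θ y * tm m η y) s n‖ ≤ ε := by
  obtain ⟨A, hA0, hA⟩ := hk.exists_abs_le
  obtain ⟨C, L, hCL⟩ := ht.bounded
  obtain ⟨C', L', hCL'⟩ := htm.bounded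
  obtain ⟨M, hM⟩ := exists_opNorm_covMatrix_sub_le hv τ (max C C')
  have hpos : 0 < ε / (M * A + 1) := by positivity
  filter_upwards [Metric.tendstoUniformlyOn_iff.1 htm.tendsto _ hpos] with m hm θ hθ s hs n
  refine (hM s hs n _ _ (A * (ε / (M * A + 1))) (by positivity) (fun y => ?_) (fun y => ?_)
    (fun y hy => ?_) fun y => ?_).trans ?_
  · rw [hk.spectral.even hθ, ht.spectral.even hη]
  · rw [hk.spectral.even hθ, ← htm.even m η hη]
  · rw [(hCL η hη y).2 ((le_max_left _ _).trans_lt hy),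
      (hCL' m η hη y).2 ((le_max_right _ _).trans_lt hy)]
  · rw [← mul_sub, abs_mul]
    have := hm (η, y) ⟨hη, Set.mem_univ _⟩
    rw [Real.dist_eq] at this
    exact mul_le_mul (hA θ hθ y) this.le (abs_nonneg _) hA0
  · have : M * (A * (ε / (M * A + 1))) = ε * (M * A / (M * A + 1)) := by ring
    rw [this]
    refine mul_le_of_le_one_right hε.le ((div_le_one (by positivity)).2 (by linarith))

/-- The approximately tapered covariance matrices are Lipschitz in the covariance parameter. -/
theorem exists_lipschitz_covMatrix_taper {l : ℕ} {Θ : Set (Euc p)} (hΘ : Convex ℝ Θ)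
    {k : Euc p → Euc d → ℝ} (hk : IsDecayingFamily Θ k) {T : Set (Euc l)}
    {t : Euc l → Euc d → ℝ} {t' : Fin l → Euc l → Euc d → ℝ}
    {tm : ℕ → Euc l → Euc d → ℝ} {tm' : ℕ → Fin l → Euc l → Euc d → ℝ}
    (htm : IsTaperApproximation T t t' tm tm') {η : Euc l} (hη : η ∈ T)
    {v : ℕ → Fin d → ℕ} (hv : Function.Injective v) (τ : ℝ) :
    ∃ D, 0 ≤ D ∧ ∀ m, ∀ θ ∈ Θ, ∀ θ' ∈ Θ, ∀ s, NearGrid τ v s → ∀ n,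
      ‖covMatrix (fun y => k θ y * tm m η y) s n - covMatrix (fun y => k θ' y * tm m η y) s n‖
        ≤ D * ‖θ - θ'‖ := by
  obtain ⟨A, hA0, hA⟩ := hk.exists_lipschitz hΘ
  obtain ⟨C, L, hCL⟩ := htm.bounded
  obtain ⟨M, hM⟩ := exists_opNorm_covMatrix_sub_le hv τ C
  refine ⟨M * (A * |L|), by positivity, fun m θ hθ θ' hθ' s hs n => ?_⟩
  refine (hM s hs n _ _ (A * ‖θ - θ'‖ * |L|) (by positivity) (fun y => ?_) (fun y => ?_)
    (fun y hy => ?_) fun y => ?_).trans (le_of_eq (by ring))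
  · rw [hk.spectral.even hθ, ← htm.even m η hη]
  · rw [hk.spectral.even hθ', ← htm.even m η hη]
  · rw [(hCL m η hη y).2 hy, mul_zero, mul_zero]
  · rw [← sub_mul, abs_mul]
    exact mul_le_mul (hA θ hθ θ' hθ' y) (((hCL m η hη y).1).trans (le_abs_self L)) (abs_nonneg _)
      (by positivity)

end Families

/-! ### Quadratic forms of Gaussian vectors at random locations -/

section GaussianForms

variable {Ω : Type*} [MeasurableSpace Ω] {P : Measure Ω} {n : ℕ}

theorem memLp_sq_gaussianReal (m : ℝ) (u : NNReal) :
    MemLp (fun x : ℝ => x ^ 2) 2 (gaussianReal m u) := by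
  rw [memLp_two_iff_integrable_sq (by fun_prop)]
  have := (memLp_id_gaussianReal (μ := m) (v := u) 4).integrable_norm_pow (by norm_num)
  refine this.congr (Eventually.of_forall fun x => ?_)
  simp only [id_eq, Real.norm_eq_abs]
  rw [← pow_mul]
  exact (Even.pow_abs (by decide) x)

/-- The variance of a quadratic form in a centred Gaussian vector, computed in coordinates in which
the form is diagonal and the vector is standard. -/
theorem lintegral_quadForm_sub_trace_sq_le [IsProbabilityMeasure P] {W : Fin n → Ω → ℝ}
    (hW : HasGaussianLaw (fun ω i => W i ω) P) (hmean : ∀ i, ∫ ω, W i ω ∂P = 0)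
    {K B : Matrix (Fin n) (Fin n) ℝ} (hK : K.PosDef) (hcov : ∀ i j, cov[W i, W j; P] = K i j)
    (hB : B.IsSymm) :
    ∫⁻ ω, ‖(fun i => W i ω) ⬝ᵥ B *ᵥ (fun i => W i ω) - (K * B).trace‖ₑ ^ 2 ∂P
      ≤ ENNReal.ofReal (Var[fun x : ℝ => x ^ 2; gaussianReal 0 1] * (B * K * (B * K)).trace) := by
  obtain ⟨Q, l, hQ, hform, hl1, hl2⟩ := exists_simultaneous_diagonalization hK hB
  set V : Fin n → Ω → ℝ := fun i ω => ∑ j, Q i j * W j ω with hVdef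
  have hVmul : ∀ ω i, (Q *ᵥ fun i => W i ω) i = V i ω := fun ω i => rfl
  have hV : HasGaussianLaw (fun ω i => V i ω) P :=
    hW.map_fun (LinearMap.toContinuousLinearMap (Matrix.mulVecLin Q))
  have hW2 : ∀ i, MemLp (W i) 2 P := fun i => (hW.eval i).memLp_two
  have hVmean : ∀ i, ∫ ω, V i ω ∂P = 0 := by
    intro i
    rw [hVdef, integral_finsetSum _ fun j _ => ((hW.eval j).integrable.const_mul _)]
    exact Finset.sum_eq_zero fun j _ => by rw [integral_const_mul, hmean, mul_zero]
  have hVcov : ∀ i j, cov[V i, V j; P] = (1 : Matrix (Fin n) (Fin n) ℝ) i j := by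
    intro i j
    rw [hVdef, covariance_fun_sum_fun_sum (fun a => (hW2 a).const_mul _)
      (fun b => (hW2 b).const_mul _), ← hQ]
    simp only [covariance_const_mul_left, covariance_const_mul_right, hcov, Matrix.mul_apply,
      Matrix.transpose_apply, Finset.sum_mul]
    rw [Finset.sum_comm]
    exact Finset.sum_congr rfl fun a _ => Finset.sum_congr rfl fun b _ => by ring
  have hVvar : ∀ i, Var[V i; P] = 1 := by
    intro i
    rw [← covariance_self (hV.eval i).aemeasurable, hVcov, Matrix.one_apply_eq]
  have hVlaw : ∀ i, P.map (V i) = gaussianReal 0 1 := by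
    intro i
    rw [(hV.eval i).map_eq_gaussianReal, hVmean, hVvar, Real.toNNReal_one]
  have hindep : iIndepFun V P := hV.iIndepFun_of_covariance_eq_zero fun i j hij => by
    rw [hVcov, Matrix.one_apply_ne hij]
  have hsq : ∀ i, MemLp (fun ω => V i ω ^ 2) 2 P := by
    intro i
    have h := memLp_sq_gaussianReal 0 1
    rw [← hVlaw i] at h
    exact h.comp_of_map (hV.eval i).aemeasurable
  have hvarsq : ∀ i, Var[fun ω => V i ω ^ 2; P] = Var[fun x : ℝ => x ^ 2; gaussianReal 0 1] := by
    intro i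
    rw [← hVlaw i, variance_map (by fun_prop) (hV.eval i).aemeasurable]
    rfl
  have hmeansq : ∀ i, ∫ ω, V i ω ^ 2 ∂P = 1 := by
    intro i
    have := variance_eq_sub (hV.eval i).memLp_two
    rw [hVvar, hVmean] at this
    simpa using this.symm
  set Y : Ω → ℝ := ∑ i, fun ω => l i * V i ω ^ 2 with hY
  have hYapp : ∀ ω, Y ω = ∑ i, l i * V i ω ^ 2 := fun ω => by rw [hY, Finset.sum_apply]
  have hYmem : ∀ i, MemLp (fun ω => l i * V i ω ^ 2) 2 P := fun i => (hsq i).const_mul _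
  have hYL : MemLp Y 2 P := memLp_finsetSum' _ fun i _ => hYmem i
  have hYmean : ∫ ω, Y ω ∂P = (K * B).trace := by
    simp only [hYapp]
    rw [integral_finsetSum _ fun i _ => (hYmem i).integrable one_le_two, ← hl1]
    exact Finset.sum_congr rfl fun i _ => by rw [integral_const_mul, hmeansq, mul_one]
  have hYvar : Var[Y; P]
      = Var[fun x : ℝ => x ^ 2; gaussianReal 0 1] * (B * K * (B * K)).trace := by
    rw [hY, IndepFun.variance_sum (fun i _ => hYmem i), ← hl2, Finset.mul_sum]
    · refine Finset.sum_congr rfl fun i _ => ?_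
      rw [variance_const_mul, hvarsq]
      ring
    · intro i _ j _ hij
      exact (hindep.indepFun hij).comp (φ := fun x => l i * x ^ 2) (ψ := fun x => l j * x ^ 2)
        (by fun_prop) (by fun_prop)
  rw [← hYvar, hYL.ofReal_variance_eq, evariance, hYmean]
  refine le_of_eq (lintegral_congr fun ω => ?_)
  rw [hYapp, hform]
  rfl

end GaussianForms

section Conditioning

variable {Ω : Type*} [MeasurableSpace Ω] {P : Measure Ω}

/-- A bound on an expectation conditionally on `X`, where the remaining randomness `J` is
independent of `X`, is a bound on the expectation. -/
theorem lintegral_le_of_indepFun [IsProbabilityMeasure P] {E Ω' : Type*} [MeasurableSpace E]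
    [MeasurableSpace Ω'] {X : Ω → E} {J : Ω → Ω'} (hX : Measurable X) (hJ : Measurable J)
    (hind : IndepFun X J P) {F : E × Ω' → ℝ≥0∞} (hF : Measurable F) {c : ℝ≥0∞}
    (h : ∀ ω, ∫⁻ ω', F (X ω, J ω') ∂P ≤ c) : ∫⁻ ω, F (X ω, J ω) ∂P ≤ c := by
  have : IsProbabilityMeasure (P.map J) := Measure.isProbabilityMeasure_map hJ.aemeasurable
  have : IsProbabilityMeasure (P.map X) := Measure.isProbabilityMeasure_map hX.aemeasurable
  have e := (indepFun_iff_map_prod_eq_prod_map_map hX.aemeasurable hJ.aemeasurable).1 hind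
  calc ∫⁻ ω, F (X ω, J ω) ∂P = ∫⁻ q, F q ∂(P.map fun ω => (X ω, J ω)) :=
        (lintegral_map hF (hX.prodMk hJ)).symm
    _ = ∫⁻ x, ∫⁻ y, F (x, y) ∂(P.map J) ∂(P.map X) := by
        rw [e, lintegral_prod _ hF.aemeasurable]
    _ = ∫⁻ ω, ∫⁻ y, F (X ω, y) ∂(P.map J) ∂P := lintegral_map hF.lintegral_prod_right' hX
    _ = ∫⁻ ω, ∫⁻ ω', F (X ω, J ω') ∂P ∂P := by
        refine lintegral_congr fun ω => ?_
        exact lintegral_map (hF.comp measurable_prodMk_left) hJ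
    _ ≤ ∫⁻ _, c ∂P := lintegral_mono h
    _ = c := by simp

/-- A random function independent of `X` factors jointly measurably through a random element
independent of `X`. -/
theorem IndepRandomFunction.exists_factor.{u} {d : ℕ} {Ω : Type u} {mΩ : MeasurableSpace Ω}
    {P : Measure Ω} {Z : Euc d → Ω → ℝ} {X : ℕ → Ω → Euc d} (h : IndepRandomFunction P Z X) :
    ∃ (Ω' : Type u) (_ : MeasurableSpace Ω') (J : Ω → Ω') (Z' : Euc d → Ω' → ℝ),
      Measurable J ∧ Measurable (fun q : Euc d × Ω' => Z' q.1 q.2) ∧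
      IndepFun (fun ω i => X i ω) J P ∧ ∀ s ω, Z' s (J ω) = Z s ω := by
  obtain ⟨𝒢, hle, hmeas, hind⟩ := h
  refine ⟨Ω, 𝒢, id, Z, hle, hmeas, ?_, fun _ _ => rfl⟩
  rw [IndepFun_iff_Indep, MeasurableSpace.comap_id]
  exact hind.symm

theorem measurable_matrix_det {E : Type*} [MeasurableSpace E] {n : ℕ}
    {A : E → Matrix (Fin n) (Fin n) ℝ} (hA : ∀ i j, Measurable fun x => A x i j) :
    Measurable fun x => (A x).det := by
  simp only [Matrix.det_apply']
  exact Finset.measurable_fun_sum _ fun σ _ =>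
    (Finset.measurable_fun_prod _ fun i _ => hA _ _).const_mul _

theorem measurable_matrix_inv {E : Type*} [MeasurableSpace E] {n : ℕ}
    {A : E → Matrix (Fin n) (Fin n) ℝ} (hA : ∀ i j, Measurable fun x => A x i j) (i j : Fin n) :
    Measurable fun x => (A x)⁻¹ i j := by
  simp only [Matrix.inv_def, Ring.inverse_eq_inv', Matrix.smul_apply, smul_eq_mul,
    Matrix.adjugate_apply]
  refine (measurable_matrix_det hA).inv.mul (measurable_matrix_det fun a b => ?_)
  by_cases h : a = j
  · subst h; simp
  · simpa [Matrix.updateRow_ne h] using hA a b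

theorem measurable_centredForm {E : Type*} [MeasurableSpace E] {n : ℕ}
    {K A : E → Matrix (Fin n) (Fin n) ℝ} {z : E → Fin n → ℝ}
    (hK : ∀ i j, Measurable fun x => K x i j) (hA : ∀ i j, Measurable fun x => A x i j)
    (hz : ∀ i, Measurable fun x => z x i) :
    Measurable fun x => centredForm (K x) (A x) (z x) := by
  have hinv := measurable_matrix_inv hA
  simp only [centredForm, dotProduct, Matrix.mulVec, Matrix.trace, Matrix.diag_apply,
    Matrix.mul_apply]
  refine Measurable.const_mul (Measurable.sub ?_ ?_) _
  · exact Finset.measurable_fun_sum _ fun i _ => (hz i).mul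
      (Finset.measurable_fun_sum _ fun j _ => (hinv i j).mul (hz j))
  · exact Finset.measurable_fun_sum _ fun i _ =>
      Finset.measurable_fun_sum _ fun j _ => (hK i j).mul (hinv j i)

theorem measurable_perturbedGrid {d : ℕ} (τ : ℝ) (v : ℕ → Fin d → ℕ) (i : ℕ) :
    Measurable fun x : ℕ → Euc d => perturbedGrid τ v x i := by
  unfold perturbedGrid
  fun_prop

theorem measurable_covMatrix_perturbedGrid {d : ℕ} {c : Euc d → ℝ} (hc : Measurable c) (τ : ℝ)
    (v : ℕ → Fin d → ℕ) {n : ℕ} (i j : Fin n) :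
    Measurable fun x : ℕ → Euc d => covMatrix c (perturbedGrid τ v x) n i j :=
  hc.comp ((measurable_perturbedGrid τ v i).sub (measurable_perturbedGrid τ v j))

theorem IsCenteredGaussianField.hasGaussianLaw {d : ℕ} {Z : Euc d → Ω → ℝ} {c : Euc d → ℝ}
    (hZ : IsCenteredGaussianField P Z c) {n : ℕ} (s : Fin n → Euc d) :
    HasGaussianLaw (fun ω i => Z (s i) ω) P := by
  classical
  have h := hZ.gaussian.hasGaussianLaw (Finset.univ.image s)
  let L : ((Finset.univ.image s) → ℝ) →L[ℝ] (Fin n → ℝ) :=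
    ContinuousLinearMap.pi fun i => ContinuousLinearMap.proj
      ⟨s i, Finset.mem_image_of_mem _ (Finset.mem_univ i)⟩
  exact h.map_fun L

/-- Second moment of the centred quadratic form at the randomly perturbed grid. -/
theorem lintegral_centredForm_sq_le {d : ℕ} [IsProbabilityMeasure P] {τ : ℝ} (hτ : 0 ≤ τ)
    {v : ℕ → Fin d → ℕ} {X : ℕ → Ω → Euc d} (hX : IsPerturbation P X) {Z : Euc d → Ω → ℝ}
    {c g : Euc d → ℝ} (hZ : IsCenteredGaussianField P Z c) (hZX : IndepRandomFunction P Z X)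
    (hc : Measurable c) (hg : Measurable g) {b a ε : ℝ} (hb : 0 < b) (ha : 0 < a) (hε : 0 ≤ ε) {n : ℕ}
    (hK : ∀ s, NearGrid τ v s → IsUniformlyPos a (covMatrix c s n))
    (hA : ∀ s, NearGrid τ v s → IsUniformlyPos b (covMatrix g s n))
    (hF : ∀ s, NearGrid τ v s → ∑ i, ∑ j, covMatrix c s n i j ^ 2 ≤ ε * (n : ℝ) ^ 2) :
    ∫⁻ ω, ‖centredForm (covMatrix c (perturbedGrid τ v fun j => X j ω) n)
        (covMatrix g (perturbedGrid τ v fun j => X j ω) n)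
        (fun i : Fin n => Z (perturbedGrid τ v (fun j => X j ω) i) ω)‖ₑ ^ 2 ∂P
      ≤ ENNReal.ofReal (Var[fun x : ℝ => x ^ 2; gaussianReal 0 1] * b⁻¹ ^ 2 * ε) := by
  obtain ⟨Ω', _, J, Z', hJ, hmeas, hind, hZ'⟩ := hZX.exists_factor
  have hXm : Measurable fun ω i => X i ω := measurable_pi_lambda _ hX.measurable
  simp only [← hZ']
  refine lintegral_le_of_indepFun hXm hJ hind
    (F := fun q => ‖centredForm (covMatrix c (perturbedGrid τ v q.1) n)
        (covMatrix g (perturbedGrid τ v q.1) n)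
        (fun i : Fin n => Z' (perturbedGrid τ v q.1 i) q.2)‖ₑ ^ 2) ?_ fun ω => ?_
  · refine (Measurable.enorm (measurable_centredForm (fun i j => ?_) (fun i j => ?_)
      fun i => ?_)).pow_const 2
    · exact (measurable_covMatrix_perturbedGrid hc τ v i j).comp measurable_fst
    · exact (measurable_covMatrix_perturbedGrid hg τ v i j).comp measurable_fst
    · exact hmeas.comp
        (((measurable_perturbedGrid τ v i).comp measurable_fst).prodMk measurable_snd)
  · set s := perturbedGrid τ v fun j => X j ω with hs
    have hnear : NearGrid τ v s := nearGrid_perturbedGrid hτ v fun i => hX.mem_cube i ω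
    set K := covMatrix c s n with hKdef
    set B := (covMatrix g s n)⁻¹ with hBdef
    have hKpos : K.PosDef := (hK s hnear).posDef ha
    have hBsymm : B.IsSymm := by
      rw [Matrix.IsSymm, hBdef, Matrix.transpose_nonsing_inv, (hA s hnear).isSymm.eq]
    have key := lintegral_quadForm_sub_trace_sq_le (P := P) (W := fun i : Fin n => Z (s i))
      (hZ.hasGaussianLaw fun i => s i) (fun i => hZ.mean _) hKpos (fun i j => hZ.cov _ _) hBsymm
    have hvar := variance_nonneg (fun x : ℝ => x ^ 2) (gaussianReal 0 1)
    have htr : (B * K * (B * K)).trace ≤ b⁻¹ ^ 2 * (ε * (n : ℝ) ^ 2) := by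
      open scoped Matrix.Norms.L2Operator in
      refine trace_mul_mul_mul_le.trans ?_
      have h1 : ‖B‖ ≤ b⁻¹ := (hA s hnear).opNorm_inv_le hb
      have h2 := hF s hnear
      gcongr
    have e : ∀ y : ℝ, ‖1 / (n : ℝ) * y‖ₑ ^ 2 = ENNReal.ofReal ((1 / (n : ℝ)) ^ 2) * ‖y‖ₑ ^ 2 := by
      intro y
      rw [enorm_mul, mul_pow, ENNReal.ofReal_pow (by positivity),
        Real.enorm_of_nonneg (by positivity)]
    simp only [centredForm, e, hZ']
    rw [lintegral_const_mul' _ _ ENNReal.ofReal_ne_top]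
    calc _ ≤ ENNReal.ofReal ((1 / (n : ℝ)) ^ 2)
          * ENNReal.ofReal (Var[fun x : ℝ => x ^ 2; gaussianReal 0 1] * (B * K * (B * K)).trace) :=
          mul_le_mul_right key _
      _ ≤ _ := by
          rw [← ENNReal.ofReal_mul (by positivity)]
          refine ENNReal.ofReal_le_ofReal ?_
          rcases n.eq_zero_or_pos with rfl | hn
          · simp only [Nat.cast_zero, div_zero, ne_eq, OfNat.ofNat_ne_zero, not_false_eq_true,
              zero_pow, zero_mul]
            positivity
          have hn' : (n : ℝ) ≠ 0 := by positivity
          calc _ ≤ (1 / (n : ℝ)) ^ 2 * (Var[fun x : ℝ => x ^ 2; gaussianReal 0 1]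
                * (b⁻¹ ^ 2 * (ε * (n : ℝ) ^ 2))) := by gcongr
            _ = _ := by field_simp

end Conditioning

/-! ### Uniform convergence in probability -/

section Uniformity

variable {Ω : Type*} [MeasurableSpace Ω] {P : Measure Ω}

/-- Pointwise convergence in probability to zero is uniform over a compact parameter set, if the
random functions are Lipschitz with tight Lipschitz constants. -/
theorem tendsto_measure_exists_ge_of_lipschitz {E : Type*} [PseudoMetricSpace E] {Θ : Set E}
    (hΘ : IsCompact Θ) {G : ℕ → E → Ω → ℝ} {Y : ℕ → Ω → ℝ}
    (hpt : ∀ θ ∈ Θ, ∀ ε > 0, Tendsto (fun n => P {ω | ε ≤ |G n θ ω|}) atTop (𝓝 0))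
    (hlip : ∀ᶠ n in atTop, ∀ ω, ∀ θ ∈ Θ, ∀ θ' ∈ Θ, |G n θ ω - G n θ' ω| ≤ dist θ θ' * Y n ω)
    (htight : ∀ η : ℝ≥0∞, 0 < η → ∃ a : ℝ, ∀ᶠ n in atTop, P {ω | a ≤ Y n ω} ≤ η)
    {ε : ℝ} (hε : 0 < ε) :
    Tendsto (fun n => P {ω | ∃ θ ∈ Θ, ε ≤ |G n θ ω|}) atTop (𝓝 0) := by
  rw [ENNReal.tendsto_nhds_zero]
  intro η hη
  have hη2 : 0 < η / 2 := ENNReal.half_pos hη.ne'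
  obtain ⟨a, ha⟩ := htight (η / 2) hη2
  -- on `{Y < a}` the oscillation over balls of this radius is at most `ε / 2`
  set ρ := ε / 2 / (|a| + 1) with hρ
  have hρ0 : 0 < ρ := by positivity
  obtain ⟨N, hNΘ, hNfin, hcov⟩ := hΘ.finite_cover_balls hρ0
  have hsum : Tendsto (fun n => ∑ θ ∈ hNfin.toFinset, P {ω | ε / 2 ≤ |G n θ ω|}) atTop (𝓝 0) := by
    have := tendsto_finsetSum hNfin.toFinset fun θ hθ =>
      hpt θ (hNΘ (hNfin.mem_toFinset.1 hθ)) (ε / 2) (by positivity)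
    simpa using this
  filter_upwards [ha, hlip, (ENNReal.tendsto_nhds_zero.1 hsum) _ hη2] with n h1 h2 h3
  have hsub : {ω | ∃ θ ∈ Θ, ε ≤ |G n θ ω|}
      ⊆ {ω | a ≤ Y n ω} ∪ ⋃ θ ∈ hNfin.toFinset, {ω | ε / 2 ≤ |G n θ ω|} := by
    rintro ω ⟨θ, hθ, hω⟩
    by_cases hY : a ≤ Y n ω
    · exact Or.inl hY
    refine Or.inr ?_
    obtain ⟨θ', hθ', hball⟩ := Set.mem_iUnion₂.1 (hcov hθ)
    refine Set.mem_iUnion₂.2 ⟨θ', hNfin.mem_toFinset.2 hθ', ?_⟩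
    have h4 := h2 ω θ hθ θ' (hNΘ hθ')
    have h5 : dist θ θ' * Y n ω ≤ ε / 2 := by
      have hYa : Y n ω ≤ |a| + 1 := by linarith [le_abs_self a]
      calc dist θ θ' * Y n ω ≤ dist θ θ' * (|a| + 1) := by gcongr
        _ ≤ ρ * (|a| + 1) := by gcongr; exact (Metric.mem_ball.1 hball).le
        _ = ε / 2 := by rw [hρ]; field_simp
    have h6 := abs_sub_abs_le_abs_sub (G n θ ω) (G n θ' ω)
    change ε / 2 ≤ |G n θ' ω|
    linarith
  calc _ ≤ _ := measure_mono hsub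
    _ ≤ P {ω | a ≤ Y n ω} + ∑ θ ∈ hNfin.toFinset, P {ω | ε / 2 ≤ |G n θ ω|} :=
        (measure_union_le _ _).trans (by gcongr; exact measure_biUnion_finset_le _ _)
    _ ≤ η / 2 + η / 2 := add_le_add h1 h3
    _ = η := ENNReal.add_halves η

theorem IndepRandomFunction.measurable_perturbedGrid {d : ℕ} {Z : Euc d → Ω → ℝ}
    {X : ℕ → Ω → Euc d} (h : IndepRandomFunction P Z X) (hX : ∀ i, Measurable (X i)) (τ : ℝ)
    (v : ℕ → Fin d → ℕ) (i : ℕ) :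
    Measurable fun ω => Z (perturbedGrid τ v (fun j => X j ω) i) ω := by
  obtain ⟨Ω', _, J, Z', hJ, hmeas, -, hZ'⟩ := h.exists_factor
  simp only [← hZ']
  exact hmeas.comp (((_root_.measurable_perturbedGrid τ v i).comp
    (measurable_pi_lambda _ hX)).prodMk hJ)

/-- The second moment of the Gaussian field at a random location equals that at a fixed one. -/
theorem lintegral_sq_perturbedGrid_le {d : ℕ} [IsProbabilityMeasure P] (τ : ℝ)
    (v : ℕ → Fin d → ℕ) {X : ℕ → Ω → Euc d} (hX : ∀ i, Measurable (X i)) {Z : Euc d → Ω → ℝ}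
    {c : Euc d → ℝ} (hZ : IsCenteredGaussianField P Z c) (hZX : IndepRandomFunction P Z X)
    (i : ℕ) :
    ∫⁻ ω, ‖Z (perturbedGrid τ v (fun j => X j ω) i) ω‖ₑ ^ 2 ∂P ≤ ENNReal.ofReal (c 0) := by
  obtain ⟨Ω', _, J, Z', hJ, hmeas, hind, hZ'⟩ := hZX.exists_factor
  simp only [← hZ']
  refine lintegral_le_of_indepFun (measurable_pi_lambda _ hX) hJ hind
    (F := fun q => ‖Z' (perturbedGrid τ v q.1 i) q.2‖ₑ ^ 2) ?_ fun ω => ?_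
  · exact (hmeas.comp (((_root_.measurable_perturbedGrid τ v i).comp measurable_fst).prodMk
      measurable_snd)).enorm.pow_const 2
  · simp only [hZ']
    set s := perturbedGrid τ v (fun j => X j ω) i
    have hL := (hZ.gaussian.hasGaussianLaw_eval s).memLp_two
    have h1 := hL.ofReal_variance_eq
    rw [← covariance_self hL.aestronglyMeasurable.aemeasurable, hZ.cov, sub_self, evariance,
      hZ.mean] at h1
    simp only [sub_zero] at h1
    exact h1.symm.le

theorem lintegral_dotProduct_self_le {d : ℕ} [IsProbabilityMeasure P] (τ : ℝ)
    (v : ℕ → Fin d → ℕ) {X : ℕ → Ω → Euc d} (hX : ∀ i, Measurable (X i)) {Z : Euc d → Ω → ℝ}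
    {c : Euc d → ℝ} (hZ : IsCenteredGaussianField P Z c) (hZX : IndepRandomFunction P Z X)
    (n : ℕ) :
    ∫⁻ ω, ENNReal.ofReal ((fun i : Fin n => Z (perturbedGrid τ v (fun j => X j ω) i) ω) ⬝ᵥ
      fun i : Fin n => Z (perturbedGrid τ v (fun j => X j ω) i) ω) ∂P
      ≤ n * ENNReal.ofReal (c 0) := by
  have e : ∀ ω, ENNReal.ofReal ((fun i : Fin n => Z (perturbedGrid τ v (fun j => X j ω) i) ω) ⬝ᵥ
      fun i : Fin n => Z (perturbedGrid τ v (fun j => X j ω) i) ω)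
      = ∑ i : Fin n, ‖Z (perturbedGrid τ v (fun j => X j ω) i) ω‖ₑ ^ 2 := by
    intro ω
    rw [dotProduct, ENNReal.ofReal_sum_of_nonneg fun i _ => mul_self_nonneg _]
    refine Finset.sum_congr rfl fun i _ => ?_
    rw [← pow_two, ← sq_abs, ENNReal.ofReal_pow (abs_nonneg _), ← Real.enorm_eq_ofReal_abs]
  simp only [e]
  rw [lintegral_finsetSum _ fun (i : Fin n) _ =>
    ((hZX.measurable_perturbedGrid hX τ v i).enorm.pow_const 2)]
  calc _ ≤ ∑ _i : Fin n, ENNReal.ofReal (c 0) :=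
        Finset.sum_le_sum fun i _ => lintegral_sq_perturbedGrid_le τ v hX hZ hZX i
    _ = _ := by simp

end Uniformity

section Consistency

open scoped Matrix.Norms.L2Operator

variable {d p : ℕ} {Ω : Type*} [MeasurableSpace Ω] {P : Measure Ω}

/-- A uniform weak law of large numbers: the normalized centred quadratic forms of the data vanish
in probability, uniformly over the covariance parameter. -/
theorem tendsto_measure_exists_centredForm_ge [IsProbabilityMeasure P] {Θ : Set (Euc p)}
    (hΘ : IsCompact Θ) {τ : ℝ} (hτ : 0 ≤ τ) {v : ℕ → Fin d → ℕ} {X : ℕ → Ω → Euc d}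
    (hX : IsPerturbation P X) {Z : Euc d → Ω → ℝ} {c : Euc d → ℝ}
    (hZ : IsCenteredGaussianField P Z c) (hZX : IndepRandomFunction P Z X)
    {g : ℕ → Euc p → Euc d → ℝ} (hc : Measurable c) (hg : ∀ n, ∀ θ ∈ Θ, Measurable (g n θ))
    {a b D : ℝ} (ha : 0 < a) (hb : 0 < b) (hD : 0 ≤ D)
    (hK : ∀ s, NearGrid τ v s → ∀ n, IsUniformlyPos a (covMatrix c s n))
    (hF : ∀ ε > 0, ∀ᶠ n : ℕ in atTop, ∀ s, NearGrid τ v s →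
      ∑ i, ∑ j, covMatrix c s n i j ^ 2 ≤ ε * (n : ℝ) ^ 2)
    (hA : ∀ᶠ n in atTop, ∀ s, NearGrid τ v s → ∀ θ ∈ Θ, IsUniformlyPos b (covMatrix (g n θ) s n))
    (hlip : ∀ n, ∀ θ ∈ Θ, ∀ θ' ∈ Θ, ∀ s, NearGrid τ v s →
      ‖covMatrix (g n θ) s n - covMatrix (g n θ') s n‖ ≤ D * ‖θ - θ'‖) {ε : ℝ} (hε : 0 < ε) :
    Tendsto (fun n => P {ω | ∃ θ ∈ Θ, ε ≤
      |centredForm (covMatrix c (perturbedGrid τ v fun j => X j ω) n)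
        (covMatrix (g n θ) (perturbedGrid τ v fun j => X j ω) n)
        (fun i : Fin n => Z (perturbedGrid τ v (fun j => X j ω) i) ω)|}) atTop (𝓝 0) := by
  have hnear : ∀ ω, NearGrid τ v (perturbedGrid τ v fun j => X j ω) := fun ω =>
    nearGrid_perturbedGrid hτ v fun i => hX.mem_cube i ω
  have hXm : Measurable fun ω i => X i ω := measurable_pi_lambda _ hX.measurable
  have hzm : ∀ i, Measurable fun ω => Z (perturbedGrid τ v (fun j => X j ω) i) ω :=
    hZX.measurable_perturbedGrid hX.measurable τ v
  refine tendsto_measure_exists_ge_of_lipschitz hΘ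
    (G := fun n θ ω => centredForm (covMatrix c (perturbedGrid τ v fun j => X j ω) n)
        (covMatrix (g n θ) (perturbedGrid τ v fun j => X j ω) n)
        (fun i : Fin n => Z (perturbedGrid τ v (fun j => X j ω) i) ω))
    (Y := fun n ω => D / b ^ 2 * (1 / (n : ℝ) *
      ((fun i : Fin n => Z (perturbedGrid τ v (fun j => X j ω) i) ω) ⬝ᵥ
        (fun i : Fin n => Z (perturbedGrid τ v (fun j => X j ω) i) ω)
        + (covMatrix c (perturbedGrid τ v fun j => X j ω) n).trace))) ?_ ?_ ?_ hε
  -- for a fixed parameter, Chebyshev's inequality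
  · intro θ hθ ε hε
    rw [ENNReal.tendsto_nhds_zero]
    intro η hη
    set κ := Var[fun x : ℝ => x ^ 2; gaussianReal 0 1] * b⁻¹ ^ 2 with hκ
    have hκ0 : 0 ≤ κ := mul_nonneg (variance_nonneg _ _) (by positivity)
    -- choose the Frobenius bound so small that Chebyshev's inequality gives `η`
    obtain ⟨ε', hε', hsmall⟩ : ∃ ε' > 0, ENNReal.ofReal (κ * ε') / ENNReal.ofReal ε ^ 2 ≤ η := by
      have hcont : Tendsto (fun x : ℝ => ENNReal.ofReal (κ * x) / ENNReal.ofReal ε ^ 2)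
          (𝓝[>] 0) (𝓝 0) := by
        have h1 : Tendsto (fun x : ℝ => ENNReal.ofReal (κ * x)) (𝓝[>] 0) (𝓝 0) := by
          have : Tendsto (fun x : ℝ => ENNReal.ofReal (κ * x)) (𝓝 0)
              (𝓝 (ENNReal.ofReal (κ * 0))) :=
            (ENNReal.continuous_ofReal.comp (continuous_const_mul κ)).tendsto 0
          rw [mul_zero, ENNReal.ofReal_zero] at this
          exact this.mono_left nhdsWithin_le_nhds
        have h2 := ENNReal.Tendsto.div_const h1 (b := ENNReal.ofReal ε ^ 2)
          (Or.inr (pow_ne_zero 2 (ENNReal.ofReal_pos.2 hε).ne'))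
        simpa using h2
      obtain ⟨x, h1, h2⟩ := (((ENNReal.tendsto_nhds_zero.1 hcont) η hη).and
        self_mem_nhdsWithin).exists
      exact ⟨x, h2, h1⟩
    filter_upwards [hF ε' hε', hA] with n hFn hAn
    have hbound := lintegral_centredForm_sq_le hτ hX hZ hZX hc (hg n θ hθ) hb ha hε'.le
      (fun s hs => hK s hs n) (fun s hs => hAn s hs θ hθ) hFn
    have hmeas : Measurable fun ω =>
        ‖centredForm (covMatrix c (perturbedGrid τ v fun j => X j ω) n)
          (covMatrix (g n θ) (perturbedGrid τ v fun j => X j ω) n)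
          (fun i : Fin n => Z (perturbedGrid τ v (fun j => X j ω) i) ω)‖ₑ ^ 2 :=
      (measurable_centredForm
        (fun i j => (measurable_covMatrix_perturbedGrid hc τ v i j).comp hXm)
        (fun i j => (measurable_covMatrix_perturbedGrid (hg n θ hθ) τ v i j).comp hXm)
        (fun i => hzm i)).enorm.pow_const 2
    have hε2 : ENNReal.ofReal ε ^ 2 ≠ 0 := pow_ne_zero 2 (ENNReal.ofReal_pos.2 hε).ne'
    refine (measure_mono fun ω hω => ?_).trans
      ((meas_ge_le_lintegral_div hmeas.aemeasurable hε2
        (ENNReal.pow_ne_top ENNReal.ofReal_ne_top)).trans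
        ((ENNReal.div_le_div_right hbound _).trans hsmall))
    change ENNReal.ofReal ε ^ 2 ≤ _
    gcongr
    rw [Real.enorm_eq_ofReal_abs]
    exact ENNReal.ofReal_le_ofReal hω
  · filter_upwards [hA] with n hAn ω θ hθ θ' hθ'
    have hs := hnear ω
    refine (abs_centredForm_sub_le hb ((hK _ hs n).posDef ha) (hAn _ hs θ hθ) (hAn _ hs θ' hθ')
      (hlip n θ hθ θ' hθ' _ hs) _).trans (le_of_eq ?_)
    rw [dist_eq_norm]
    ring
  -- tightness of the Lipschitz constants
  · intro η hη
    have hc0 : 0 ≤ c 0 := by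
      have h := (hK (fun i => WithLp.toLp 2 fun j => (v i j : ℝ)) (fun i j => by simpa using hτ)
        1).le_diag 0
      simp only [covMatrix, Matrix.of_apply, sub_self] at h
      linarith
    set C := D / b ^ 2 with hC
    have hC0 : 0 ≤ C := by positivity
    -- a level at which Markov's inequality, with the mean bounded by `C · 2 c(0)`, gives `η`
    obtain ⟨x, hx0, hx⟩ : ∃ x : ℝ, 0 < x ∧
        ENNReal.ofReal (C * (2 * c 0)) / ENNReal.ofReal x ≤ η := by
      have hlim : Tendsto (fun x : ℝ => ENNReal.ofReal (C * (2 * c 0)) / ENNReal.ofReal x) atTop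
          (𝓝 0) := by
        have h1 := ENNReal.Tendsto.const_div (a := ENNReal.ofReal (C * (2 * c 0)))
          ENNReal.tendsto_ofReal_atTop (Or.inr ENNReal.ofReal_ne_top)
        simpa using h1
      obtain ⟨x, h1, h2⟩ := (((ENNReal.tendsto_nhds_zero.1 hlim) η hη).and
        (eventually_gt_atTop 0)).exists
      exact ⟨x, h2, h1⟩
    refine ⟨x, Eventually.of_forall fun n => ?_⟩
    have hdot : Measurable fun ω => (fun i : Fin n => Z (perturbedGrid τ v (fun j => X j ω) i) ω) ⬝ᵥ
        fun i : Fin n => Z (perturbedGrid τ v (fun j => X j ω) i) ω :=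
      Finset.measurable_fun_sum _ fun i _ => (hzm i).mul (hzm i)
    simp only [trace_covMatrix]
    have hmeas : Measurable fun ω => ENNReal.ofReal (C * (1 / (n : ℝ) *
        ((fun i : Fin n => Z (perturbedGrid τ v (fun j => X j ω) i) ω) ⬝ᵥ
          (fun i : Fin n => Z (perturbedGrid τ v (fun j => X j ω) i) ω) + n * c 0))) :=
      (((hdot.add_const _).const_mul _).const_mul _).ennreal_ofReal
    refine (measure_mono fun ω hω => ?_).trans
      ((meas_ge_le_lintegral_div hmeas.aemeasurable (ENNReal.ofReal_pos.2 hx0).ne'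
        ENNReal.ofReal_ne_top).trans ((ENNReal.div_le_div_right ?_ _).trans hx))
    · exact ENNReal.ofReal_le_ofReal hω
    have e : ∀ y : ℝ, 0 ≤ y → ENNReal.ofReal (C * (1 / (n : ℝ) * (y + n * c 0)))
        = ENNReal.ofReal (C * (1 / (n : ℝ))) * (ENNReal.ofReal y + ENNReal.ofReal (n * c 0)) := by
      intro y hy
      rw [← ENNReal.ofReal_add hy (by positivity), ← ENNReal.ofReal_mul (by positivity), mul_assoc]
    have hnn : ∀ z : Fin n → ℝ, 0 ≤ z ⬝ᵥ z := fun z => by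
      rw [dotProduct_self_eq_norm_sq]; positivity
    simp only [e _ (hnn _)]
    rw [lintegral_const_mul' _ _ ENNReal.ofReal_ne_top,
      lintegral_add_right _ measurable_const, lintegral_const, measure_univ, mul_one]
    calc _ ≤ ENNReal.ofReal (C * (1 / (n : ℝ)))
          * (n * ENNReal.ofReal (c 0) + ENNReal.ofReal (n * c 0)) := by
          gcongr
          exact lintegral_dotProduct_self_le τ v hX.measurable hZ hZX n
      _ = ENNReal.ofReal (C * (1 / (n : ℝ)) * (n * c 0 + n * c 0)) := by
          rw [ENNReal.ofReal_mul (p := C * (1 / (n : ℝ))) (by positivity),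
            ENNReal.ofReal_add (by positivity) (by positivity),
            ENNReal.ofReal_mul (p := (n : ℝ)) (by positivity), ENNReal.ofReal_natCast]
      _ ≤ _ := by
          refine ENNReal.ofReal_le_ofReal ?_
          calc C * (1 / (n : ℝ)) * (n * c 0 + n * c 0) = C * (2 * c 0) * (n / n : ℝ) := by ring
            _ ≤ C * (2 * c 0) * 1 := by gcongr; exact div_self_le_one _
            _ = _ := mul_one _

end Consistency

end

/-! ### Consistency of truncated-tapered estimation -/

theorem mainTheorem4 {d p l : ℕ} (hd : 0 < d)
    {Ω : Type*} [MeasurableSpace Ω] (P : Measure Ω) [IsProbabilityMeasure P]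
    -- parameter spaces
    (Θ : Set (Euc p)) (hΘ : IsCompact Θ) (hΘ' : Convex ℝ Θ) (θ₀ : Euc p) (hθ₀ : θ₀ ∈ Θ)
    (T : Set (Euc l)) (hT : IsCompact T) (hT' : Convex ℝ T) (η₀ : Euc l) (hη₀ : η₀ ∈ T)
    -- covariance functions, tapers and taper approximations
    (k : Euc p → Euc d → ℝ) (hk : IsDecayingFamily Θ k)
    (t : Euc l → Euc d → ℝ) (t' : Fin l → Euc l → Euc d → ℝ) (ht : IsTaperFamily T t t')
    (tm : ℕ → Euc l → Euc d → ℝ) (tm' : ℕ → Fin l → Euc l → Euc d → ℝ)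
    (htm : IsTaperApproximation T t t' tm tm')
    (r : ℕ → ℕ) (hr : Tendsto r atTop atTop)
    -- randomly perturbed regular grid `S` and Gaussian random field `Z`
    (τ : ℝ) (hτ₀ : 0 ≤ τ) (hτ₁ : τ < 1 / 2)
    (v : ℕ → Fin d → ℕ) (hv : IsGridEnumeration v)
    (X : ℕ → Ω → Euc d) (hX : IsPerturbation P X)
    (Z : Euc d → Ω → ℝ) (hZ : IsCenteredGaussianField P Z (k θ₀))
    (hZX : IndepRandomFunction P Z X)
    (S : ℕ → Ω → Euc d) (hS : ∀ i ω, S i ω = perturbedGrid τ v (fun j => X j ω) i)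
    -- true, tapered and approximately tapered covariance matrices
    (K : (n : ℕ) → Ω → Matrix (Fin n) (Fin n) ℝ)
    (hK : ∀ n ω, K n ω = covMatrix (k θ₀) (fun i => S i ω) n)
    (R : (n : ℕ) → Euc p → Ω → Matrix (Fin n) (Fin n) ℝ)
    (hR : ∀ n θ ω, R n θ ω = covMatrix (fun s => k θ s * t η₀ s) (fun i => S i ω) n)
    (R' : (n : ℕ) → Euc p → Ω → Matrix (Fin n) (Fin n) ℝ)
    (hR' : ∀ n θ ω, R' n θ ω = covMatrix (fun s => k θ s * tm (r n) η₀ s) (fun i => S i ω) n) :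
    -- the divergences are well defined for all large `n`
    (∃ N : ℕ, ∀ᵐ ω ∂P, ∀ n : ℕ, (K n ω).PosDef ∧ (∀ θ ∈ Θ, (R n θ ω).PosDef) ∧
      (N ≤ n → ∀ θ ∈ Θ, (R' n θ ω).PosDef)) ∧
    -- they converge to each other uniformly in `θ`
    (∀ᵐ ω ∂P, Tendsto
      (fun n => ⨆ θ ∈ Θ, ‖scaledKL (K n ω) (R n θ ω) - scaledKL (K n ω) (R' n θ ω)‖ₑ)
      atTop (𝓝 0)) ∧
    -- truncated-tapered ML estimators asymptotically minimize the divergence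
    (∀ θhat : ℕ → Ω → Euc p,
      IsTruncatedMLE P Θ (fun n θ s => k θ s * tm (r n) η₀ s) S Z θhat →
      TendstoInMeasure P
        (fun n ω => scaledKL (K n ω) (R n (θhat n ω) ω) - ⨅ θ : Θ, scaledKL (K n ω) (R n θ ω))
        atTop (fun _ => 0)) := by
  open scoped Matrix.Norms.L2Operator in
  have hinj := hv.injective hd
  set s : Ω → ℕ → Euc d := fun ω => perturbedGrid τ v fun j => X j ω with hs
  have hSs : ∀ ω, (fun i => S i ω) = s ω := fun ω => funext fun i => hS i ω
  have hnear : ∀ ω, NearGrid τ v (s ω) := fun ω =>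
    nearGrid_perturbedGrid hτ₀ v fun i => hX.mem_cube i ω
  simp only [hSs] at hK hR hR'
  -- uniform lower bounds for the eigenvalues
  obtain ⟨a, ha, hKpos⟩ := hk.spectral.exists_isUniformlyPos hΘ hinj hτ₀ hτ₁
  obtain ⟨b, hb, hTpos⟩ := ht.spectral.exists_isUniformlyPos hT hinj hτ₀ hτ₁
  have hab : 0 < a * b := mul_pos ha hb
  have hRpos : ∀ θ ∈ Θ, ∀ x, NearGrid τ v x → ∀ n,
      IsUniformlyPos (a * b) (covMatrix (fun y => k θ y * t η₀ y) x n) := fun θ hθ x hx n =>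
    (hKpos θ hθ x hx n).covMatrix_mul ha.le hb (hTpos η₀ hη₀ x hx n)
  have hclose : ∀ ε > 0, ∀ᶠ n in atTop, ∀ θ ∈ Θ, ∀ x, NearGrid τ v x → ∀ m,
      ‖covMatrix (fun y => k θ y * t η₀ y) x m
        - covMatrix (fun y => k θ y * tm (r n) η₀ y) x m‖ ≤ ε := fun ε hε =>
    hr.eventually (eventually_opNorm_covMatrix_taper_sub_le hk ht htm hη₀ hinj τ hε)
  have hR'pos : ∀ᶠ n in atTop, ∀ θ ∈ Θ, ∀ x, NearGrid τ v x → ∀ m,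
      IsUniformlyPos (a * b / 2) (covMatrix (fun y => k θ y * tm (r n) η₀ y) x m) := by
    filter_upwards [hclose (a * b / 2) (by positivity)] with n hn θ hθ x hx m
    have hsymm : (covMatrix (fun y => k θ y * tm (r n) η₀ y) x m).IsSymm :=
      isSymm_covMatrix (fun y => by rw [hk.spectral.even hθ, ← htm.even _ η₀ hη₀]) x m
    exact ((hRpos θ hθ x hx m).of_opNorm_sub_le hsymm (hn θ hθ x hx m)).mono (by linarith)
  have hK' : ∀ n ω, (K n ω).PosDef := fun n ω => by
    rw [hK]; exact (hKpos θ₀ hθ₀ _ (hnear ω) n).posDef ha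
  have hR'' : ∀ n ω, ∀ θ ∈ Θ, (R n θ ω).PosDef := fun n ω θ hθ => by
    rw [hR]; exact (hRpos θ hθ _ (hnear ω) n).posDef hab
  have hk0 : 0 ≤ k θ₀ 0 := by
    have h := (hKpos θ₀ hθ₀ (fun i => WithLp.toLp 2 fun j => (v i j : ℝ))
      (fun i j => by simpa using hτ₀) 1).le_diag 0
    simp only [covMatrix, Matrix.of_apply, sub_self] at h
    linarith
  -- the divergences are uniformly close
  have hdiv : ∀ ε > 0, ∀ᶠ n in atTop, ∀ ω, ∀ θ ∈ Θ,
      |scaledKL (K n ω) (R n θ ω) - scaledKL (K n ω) (R' n θ ω)| ≤ ε := by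
    intro ε hε
    set c := a * b / 2 with hc
    have hc0 : 0 < c := by positivity
    set q := 1 / c + 1 / c ^ 2 * k θ₀ 0 with hq
    have hq0 : 0 < q := by positivity
    filter_upwards [hclose (ε / q) (by positivity), hR'pos] with n h1 h2 ω θ hθ
    have h3 := abs_scaledKL_sub_le (κ := k θ₀ 0) hc0 (hK' n ω)
      (by rw [hK, trace_covMatrix])
      ((hRpos θ hθ _ (hnear ω) n).mono (by linarith)) (h2 θ hθ _ (hnear ω) n) hk0
      (h1 θ hθ _ (hnear ω) n)
    rw [hR, hR']
    refine h3.trans (le_of_eq ?_)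
    calc ε / q / c + ε / q / c ^ 2 * k θ₀ 0 = ε / q * q := by rw [hq]; ring
      _ = ε := by field_simp
  refine ⟨?_, ?_, ?_⟩
  · obtain ⟨N, hN⟩ := eventually_atTop.1 hR'pos
    refine ⟨N, Eventually.of_forall fun ω n => ⟨hK' n ω, hR'' n ω, fun hn θ hθ => ?_⟩⟩
    rw [hR']
    exact (hN n hn θ hθ _ (hnear ω) n).posDef (by positivity)
  · refine Eventually.of_forall fun ω => ?_
    rw [ENNReal.tendsto_nhds_zero]
    intro ε hε
    obtain ⟨ε', hε', hle⟩ : ∃ ε' : ℝ, 0 < ε' ∧ ENNReal.ofReal ε' ≤ ε := by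
      obtain ⟨x, hx0, hx⟩ := ENNReal.lt_iff_exists_nnreal_btwn.1 hε
      exact ⟨x, by exact_mod_cast hx0, by rw [ENNReal.ofReal_coe_nnreal]; exact hx.le⟩
    filter_upwards [hdiv ε' hε'] with n hn
    refine iSup₂_le fun θ hθ => le_trans ?_ hle
    rw [Real.enorm_eq_ofReal_abs]
    exact ENNReal.ofReal_le_ofReal (hn ω θ hθ)
  · intro θhat hθhat
    rw [tendstoInMeasure_iff_norm]
    intro ε hε
    obtain ⟨D, hD, hlip⟩ := exists_lipschitz_covMatrix_taper hΘ' hk htm hη₀ hinj τ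
    obtain ⟨A, -, hA⟩ := hk.exists_abs_le
    have hulln := tendsto_measure_exists_centredForm_ge (ε := ε / 8) hΘ hτ₀ hX hZ hZX
      (g := fun n θ y => k θ y * tm (r n) η₀ y) (hk.spectral.continuous hθ₀).measurable
      (fun n θ hθ => (hk.spectral.continuous hθ).measurable.mul (htm.measurable _ η₀ hη₀))
      ha (half_pos hab) hD (hKpos θ₀ hθ₀)
      (fun ε hε => eventually_sum_sq_covMatrix_le hinj τ (hA θ₀ hθ₀)
        (fun η hη => hk.tendsto_zero hθ₀ hη) hε)
      (hR'pos.mono fun n hn x hx θ hθ => hn θ hθ x hx n)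
      (fun n θ hθ θ' hθ' x hx => hlip (r n) θ hθ θ' hθ' x hx n) (by positivity)
    -- up to a null set, a bad estimate forces a large centred quadratic form somewhere on `Θ`
    refine tendsto_of_tendsto_of_tendsto_of_le_of_le' tendsto_const_nhds hulln
      (Eventually.of_forall fun n => zero_le) ?_
    filter_upwards [hθhat, hdiv (ε / 8) (by positivity), hR'pos] with n hmin hdn hpos
    refine measure_mono_ae ?_
    filter_upwards [hmin] with ω hω hbad
    by_contra hgood
    have hgood' : ∀ θ ∈ Θ, |centredForm (K n ω) (R' n θ ω) fun i : Fin n => Z (S i ω) ω|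
        ≤ ε / 8 := by
      intro θ hθ
      by_contra hlt
      refine hgood ⟨θ, hθ, ?_⟩
      have hle := (not_le.1 hlt).le
      simp only [hS] at hle
      rw [hK, hR'] at hle
      exact hle
    have hbound := sub_ciInf_le_of_minimizer (ι := Θ)
      (a := fun θ => truncLogLik (R' n θ ω) fun i : Fin n => Z (S i ω) ω)
      (b := fun θ => scaledKL (K n ω) (R n θ ω)) (b' := fun θ => scaledKL (K n ω) (R' n θ ω))
      (C := 1 / (n : ℝ) * Real.log (K n ω).det + 1) (u := ε / 8) (w := ε / 8)
      (i₀ := ⟨θhat n ω, hω.1⟩) (fun θ => ?_) (fun θ => hdn ω θ θ.2) (fun θ => ?_) ?_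
    · have hbad' : ε ≤ ‖scaledKL (K n ω) (R n (θhat n ω) ω)
          - (⨅ θ : Θ, scaledKL (K n ω) (R n θ ω)) - 0‖ := hbad
      rw [sub_zero, Real.norm_eq_abs] at hbad'
      have := hbad'.trans hbound
      linarith
    · have := hω.2 θ θ.2
      simp only [hSs] at this
      simp only [hR']
      exact this
    · have hpd : (R' n θ ω).PosDef := by
        rw [hR']; exact (hpos θ θ.2 _ (hnear ω) n).posDef (half_pos hab)
      rw [truncLogLik_eq (hK' n ω) hpd]
      refine le_trans (le_of_eq ?_) (hgood' θ θ.2)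
      congr 1
      ring
    · refine ⟨-1, ?_⟩
      rintro _ ⟨θ, rfl⟩
      exact neg_one_le_scaledKL (hK' n ω) (hR'' n ω θ θ.2)
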